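/- **System.** Let $N,n,n_o\ge 1$. Consider $$\dot x_i=f_i(\bar x_i)+g_i(\bar x_i)x_{i+1}+w_i(t)\ (1\le i\le N-1),\qquad \dot x_N=f_N(\bar x_N)+g_N(\bar x_N)u+w_N(t),\qquad y=x_1,$$ with $x_i,u\in\mathbb R^n$ and $\bar x_i=(x_1,\dots,x_i)$. All $f_i:\mathbb R^{ni}\to\mathbb R^n$ and $g_i:\mathbb R^{ni}\to\mathbb R^{n\times n}$ are locally Lipschitz; for each $i$ there is $\underline g_i>0$ such that every eigenvalue of $\tfrac12(g_i(\bar x_i)+g_i(\bar x_i)^\top)$ is at least $\underline g_i$, for all $\bar x_i$; the disturbances $w_i$ are measurable with values in a bounded set. Solutions are understood in the sense of Carathéodory. **Obstacles and task.** For $j=1,\dots,n_o$, obstacle $j$ at time $t\ge0$ is the closed ball of radius $\mathsf r_o^{(j)}(t)>0$ about a random vector $O^{(j)}(t)\sim\mathcal N(\mu^{(j)}(t),\sigma^{(j)}(t)^2I_n)$, $\sigma^{(j)}>0$, where $\mu^{(j)},\sigma^{(j)},\mathsf r_o^{(j)}$ are continuously differentiable on $[0,\infty)$. Let $\varepsilon^{(j)}\in(0,1]$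 and let $\mathbf S,\mathbf T\subset\mathbb R^n$ with $\mathbb P(\|x-O^{(j)}(0)\|\ge\mathsf r_o^{(j)}(0))\ge\varepsilon^{(j)}$ for all $x\in\mathbf S$ and all $j$. A curve $y$ satisfies the PrT-RAS task if $y(0)\in\mathbf S$; there is $t_c\ge0$ with $y(t)\in\mathbf T$ for all $t\ge t_c$; and $\mathbb P(\|y(t)-O^{(j)}(t)\|\ge\mathsf r_o^{(j)}(t))\ge\varepsilon^{(j)}$ for all $j$ and $t\ge0$. **Tube.** Choose $s,\eta\in\mathbb R^n$ and $d_S,d_T>0$ such that the closed balls $\mathcal B(s,d_S)\subset\mathbf S$, $\mathcal B(\eta,d_T)\subset\mathbf T$; $0<r_{min}<r_{max}\le\min(d_S,d_T)$; $\nu,k_1,k_{2,j},k_{3,j}>0$; and $p_d^{(j)}\in(\varepsilon^{(j)},1]$. Put $\mathsf r_s^{(j)}=\mathsf r_o^{(j)}+r_{min}$ and $q^{(j)}(x,t)=1-\mathbb P(\|x-O^{(j)}(t)\|<\mathsf r_s^{(j)}(t))$. Let the centre $c:[0,\infty)\to\mathbb R^n$ solve, for all $t\ge 0$, $$\dot c=k_1(\eta-c)^{1/3}+\sum_{j=1}^{n_o}\theta^{(j)}\,(k_{2,j}m^{(j)}+k_{3,j}v^{(j)}),\qquad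 c(0)=s,$$ where the real cube root is taken componentwise, $\theta^{(j)}=\frac1{q^{(j)}(c,t)}-\frac1{p_d^{(j)}}$ if $q^{(j)}(c,t)\le p_d^{(j)}$ and $\theta^{(j)}=0$ otherwise, $m^{(j)}=\frac{c-\mu^{(j)}}{q^{(j)}(c,t)-\varepsilon^{(j)}}$ (the denominator being nonzero at all times), and $v^{(j)}$ is continuous with $m^{(j)\top}v^{(j)}=0$. Assume that for some $t_1\ge0$, $\mathbb P(\|c(t)-O^{(j)}(t)\|\ge\mathsf r_s^{(j)}(t))\ge p_d^{(j)}$ for all $t\ge t_1$ and all $j$. With $F_{j,t}$ the distribution function of $\|(c(t)-O^{(j)}(t))/\sigma^{(j)}(t)\|^2$, put $$\hat d^{(j)}=\sigma^{(j)}\sqrt{F_{j,t}^{-1}(1-\varepsilon^{(j)})}-\mathsf r_o^{(j)},\qquad d=-\tfrac1\nu\ln\sum_{j=1}^{n_o}e^{-\nu\hat d^{(j)}},$$ and let the radius $r:[0,\infty)\to(0,\infty)$ solve $$\dot r=\frac{e^{-\nu d}\,\dot d}{e^{-\nu r_{max}}+e^{-\nu d}},\qquad r(0)=-\tfrac1\nu\ln\big(e^{-\nu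 r_{max}}+e^{-\nu d(0)}\big).$$ The tube is the closed ball $\Gamma(t)=\mathcal B(c(t),r(t))$. **Controller.** Let $\kappa_k>0$ and $\ell(e)=\ln\frac{1+e}{1-e}$. Put $$r_2=-\kappa_1\,\ell\big(\|x_1-c\|/r\big)\,(x_1-c),$$ and, for $2\le k\le N$, $$\gamma_{k,i}(t)=(p_{k,i}-q_{k,i})e^{-\mu_{k,i}t}+q_{k,i},\quad e_{k,i}=\frac{x_{k,i}-r_{k,i}}{\gamma_{k,i}},\quad \rho_k=(\ell(e_{k,i}))_{i},\quad \xi_k=4\,\mathrm{diag}(\gamma_{k,i})^{-1}(I_n-\mathrm{diag}(e_{k,i}^2))^{-1},\quad r_{k+1}=-\kappa_k\xi_k\rho_k,$$ with $p_{k,i}>q_{k,i}>0$, $\mu_{k,i}\ge0$. The control is $u=r_{N+1}$. **Theorem.** Suppose $y(0)$ lies in the interior of $\Gamma(0)$, i.e. $\|y(0)-c(0)\|<r(0)$, and $|x_{k,i}(0)-r_{k,i}(0)|<p_{k,i}$ for $2\le k\le N$, $1\le i\le n$. Then the closed loop has a solution on $[0,\infty)$ with the given initial state; every solution on an interval $[0,T]$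 with that initial state is a restriction of it; $y(t)\in\Gamma(t)$ for all $t\ge0$; and $y$ satisfies the PrT-RAS task. -/

import Mathlib

open MeasureTheory ProbabilityTheory Set

noncomputable section

namespace PrTRAS

/-- The output space `ℝⁿ` with its Euclidean norm. -/
abbrev E (n : ℕ) : Type := EuclideanSpace ℝ (Fin n)

/-! ## The pure-feedback system -/

/-- The data of a pure-feedback MIMO system with `N` blocks of dimension `n`. Blocks are numbered
from `0`; the maps of block `i` see the blocks `j ≤ i` only. -/
structure PureFeedbackSystem (N n : ℕ) where
  f : (i : Fin N) → ({j : Fin N // j ≤ i} → E n) → E n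
  g : (i : Fin N) → ({j : Fin N // j ≤ i} → E n) → Matrix (Fin n) (Fin n) ℝ

/-- All `f_i` and all (entries of) `g_i` are locally Lipschitz. -/
def PureFeedbackSystem.LocLipschitz {N n : ℕ} (sys : PureFeedbackSystem N n) : Prop :=
  ∀ i : Fin N, LocallyLipschitz (sys.f i) ∧
    ∀ a b : Fin n, LocallyLipschitz (fun z => sys.g i z a b)

/-- The symmetric part of a square matrix. -/
def symPart {n : ℕ} (A : Matrix (Fin n) (Fin n) ℝ) : Matrix (Fin n) (Fin n) ℝ :=
  (1 / 2 : ℝ) • (A + A.transpose)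

theorem symPart_isHermitian {n : ℕ} (A : Matrix (Fin n) (Fin n) ℝ) :
    (symPart A).IsHermitian := by
  ext a b
  simp only [symPart, Matrix.conjTranspose_apply, Matrix.smul_apply, Matrix.add_apply,
    Matrix.transpose_apply, star_trivial, add_comm]

/-- For every `i` there is a constant `glow > 0` below every eigenvalue of the symmetric part of
`g_i`, at every point. -/
def PureFeedbackSystem.UniformlyPosDef {N n : ℕ} (sys : PureFeedbackSystem N n) : Prop :=
  ∀ i : Fin N, ∃ glow : ℝ, 0 < glow ∧
    ∀ z, ∀ a : Fin n, glow ≤ (symPart_isHermitian (sys.g i z)).eigenvalues a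

/-- The signal that drives block `i`: the next block, or the input `u` for the last block. -/
def drive {N n : ℕ} (x : Fin N → E n) (u : E n) (i : Fin N) : E n :=
  if h : i.1 + 1 < N then x ⟨i.1 + 1, h⟩ else u

/-- The right-hand side of block `i`, at state `x`, input `u` and disturbance value `d`. -/
def PureFeedbackSystem.velocity {N n : ℕ} (sys : PureFeedbackSystem N n)
    (x : Fin N → E n) (u d : E n) (i : Fin N) : E n :=
  sys.f i (fun j => x j.1) + Matrix.toEuclideanLin (sys.g i (fun j => x j.1)) (drive x u i) + d

/-- `x` solves the system on `[0, T]`, with feedback `u` and disturbances `w`, in the sense of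
Carathéodory (the disturbances need not be continuous in time). -/
def PureFeedbackSystem.IsSolutionOn {N n : ℕ} (sys : PureFeedbackSystem N n)
    (u : (Fin N → E n) → ℝ → E n) (w : Fin N → ℝ → E n) (x : ℝ → Fin N → E n) (T : ℝ) : Prop :=
  ∀ i : Fin N,
    IntervalIntegrable (fun s => sys.velocity (x s) (u (x s) s) (w i s) i) volume 0 T ∧
    ∀ t ∈ Icc 0 T,
      x t i = x 0 i + ∫ s in (0 : ℝ)..t, sys.velocity (x s) (u (x s) s) (w i s) i

/-- The disturbances are measurable and take values in one bounded set. -/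
def IsDisturbance {N n : ℕ} (w : Fin N → ℝ → E n) : Prop :=
  (∀ i, Measurable (w i)) ∧
    ∃ W : Set (E n), Bornology.IsBounded W ∧ ∀ i, ∀ t, 0 ≤ t → w i t ∈ W

/-! ## Uncertain obstacles and the task -/

/-- `no` obstacles: time-varying closed balls whose centres are Gaussian random vectors with mean
`mean j t` and covariance `(sd j t)² I`, and whose radii are known. -/
structure Obstacles {Ω : Type*} [MeasurableSpace Ω] (P : Measure Ω) (n no : ℕ) where
  centre : Fin no → ℝ → Ω → E n
  mean : Fin no → ℝ → E n
  sd : Fin no → ℝ → ℝ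
  radius : Fin no → ℝ → ℝ
  sd_pos : ∀ j t, 0 ≤ t → 0 < sd j t
  radius_pos : ∀ j t, 0 ≤ t → 0 < radius j t
  law : ∀ j t, 0 ≤ t →
    HasLaw (centre j t)
      (multivariateGaussian (mean j t) ((sd j t) ^ 2 • (1 : Matrix (Fin n) (Fin n) ℝ))) P
  mean_smooth : ∀ j, ContDiffOn ℝ 1 (mean j) (Ici 0)
  sd_smooth : ∀ j, ContDiffOn ℝ 1 (sd j) (Ici 0)
  radius_smooth : ∀ j, ContDiffOn ℝ 1 (radius j) (Ici 0)

section Task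

variable {Ω : Type*} [MeasurableSpace Ω] {P : Measure Ω} {n no : ℕ}

/-- A probabilistic temporal reach-avoid-stay task: initial set, target set and minimum avoidance
probabilities; every initial point is safe with the required probability. -/
structure RASTask (ob : Obstacles P n no) where
  S : Set (E n)
  T : Set (E n)
  eps : Fin no → ℝ
  eps_mem : ∀ j, eps j ∈ Ioc (0 : ℝ) 1
  safe_start : ∀ s ∈ S, ∀ j,
    eps j ≤ P.real {ω | ob.radius j 0 ≤ ‖s - ob.centre j 0 ω‖}

/-- The output `y` satisfies the task. -/
def RASTask.Satisfies {ob : Obstacles P n no} (task : RASTask ob) (y : ℝ → E n) : Prop :=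
  y 0 ∈ task.S ∧
  (∃ tc : ℝ, 0 ≤ tc ∧ ∀ t, tc ≤ t → y t ∈ task.T) ∧
  ∀ j, ∀ t, 0 ≤ t →
    task.eps j ≤ P.real {ω | ob.radius j t ≤ ‖y t - ob.centre j t ω‖}

/-! ## The spatiotemporal tube -/

/-- The design parameters of the tube. -/
structure TubeDesign {ob : Obstacles P n no} (task : RASTask ob) where
  s : E n
  eta : E n
  dS : ℝ
  dT : ℝ
  dS_pos : 0 < dS
  dT_pos : 0 < dT
  ball_S : Metric.closedBall s dS ⊆ task.S
  ball_T : Metric.closedBall eta dT ⊆ task.T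
  rmin : ℝ
  rmax : ℝ
  rmin_pos : 0 < rmin
  rmin_lt : rmin < rmax
  rmax_le : rmax ≤ min dS dT
  nu : ℝ
  nu_pos : 0 < nu
  k1 : ℝ
  k1_pos : 0 < k1
  k2 : Fin no → ℝ
  k2_pos : ∀ j, 0 < k2 j
  k3 : Fin no → ℝ
  k3_pos : ∀ j, 0 < k3 j
  pd : Fin no → ℝ
  pd_mem : ∀ j, pd j ∈ Ioc (task.eps j) 1

variable {ob : Obstacles P n no} {task : RASTask ob}

/-- The safety radius: obstacle radius plus buffer margin. -/
def TubeDesign.safeRadius (D : TubeDesign task) (j : Fin no) (t : ℝ) : ℝ :=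
  ob.radius j t + D.rmin

/-- The probability that the point `x` avoids obstacle `j`, enlarged by the margin, at time `t`. -/
def TubeDesign.q (D : TubeDesign task) (j : Fin no) (x : E n) (t : ℝ) : ℝ :=
  1 - P.real {ω | ‖x - ob.centre j t ω‖ < D.safeRadius j t}

open Classical in
/-- The switching function. -/
def TubeDesign.theta (D : TubeDesign task) (c : ℝ → E n) (j : Fin no) (t : ℝ) : ℝ :=
  if D.q j (c t) t ≤ D.pd j then 1 / D.q j (c t) t - 1 / D.pd j else 0

/-- The repulsion vector. -/
def TubeDesign.m (D : TubeDesign task) (c : ℝ → E n) (j : Fin no) (t : ℝ) : E n :=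
  (D.q j (c t) t - task.eps j)⁻¹ • (c t - ob.mean j t)

/-- The real cube root (negative on negative numbers). -/
def cbrt (a : ℝ) : ℝ := Real.sign a * |a| ^ (1 / 3 : ℝ)

/-- The componentwise cube root of a vector. -/
def cbrtVec (z : E n) : E n := WithLp.toLp 2 (fun i => cbrt (z i))

/-- The centre `c` starts at `s` and evolves by the centre law for all time; in particular the
denominators in the law do not vanish. The vectors `v j t` are orthogonal to `m j t`. -/
structure TubeDesign.CentreLaw (D : TubeDesign task) (v : Fin no → ℝ → E n)
    (c : ℝ → E n) : Prop where
  init : c 0 = D.s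
  v_cont : ∀ j, ContinuousOn (v j) (Ici 0)
  v_orth : ∀ j t, 0 ≤ t → inner ℝ (D.m c j t) (v j t) = 0
  denom : ∀ j t, 0 ≤ t → D.q j (c t) t ≠ task.eps j
  ode : ∀ t, 0 ≤ t → HasDerivWithinAt c
    (D.k1 • cbrtVec (D.eta - c t) +
      ∑ j, D.theta c j t • (D.k2 j • D.m c j t + D.k3 j • v j t)) (Ici 0) t

/-- After some time `t1`, the centre avoids every enlarged obstacle with probability at least
`pd j`. -/
def TubeDesign.EventuallySeparated (D : TubeDesign task) (c : ℝ → E n) : Prop :=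
  ∃ t1 : ℝ, 0 ≤ t1 ∧ ∀ j t, t1 ≤ t →
    D.pd j ≤ P.real {ω | D.safeRadius j t ≤ ‖c t - ob.centre j t ω‖}

/-- The distribution function of `‖(c(t) - O_j(t)) / σ_j(t)‖²` (a non-central chi-squared one). -/
def distCdf (ob : Obstacles P n no) (c : ℝ → E n) (j : Fin no) (t : ℝ) : ℝ → ℝ :=
  fun a => cdf (P.map (fun ω => ‖(ob.sd j t)⁻¹ • (c t - ob.centre j t ω)‖ ^ 2)) a

/-- The inverse (quantile function) of a distribution function. -/
def quantile (F : ℝ → ℝ) (p : ℝ) : ℝ := sInf {a | p ≤ F a}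

/-- The distance of the centre from the region around obstacle `j` in which the avoidance
probability is below `eps j`. -/
def dHat (task : RASTask ob) (c : ℝ → E n) (j : Fin no) (t : ℝ) : ℝ :=
  ob.sd j t * Real.sqrt (quantile (distCdf ob c j t) (1 - task.eps j)) - ob.radius j t

/-- The smooth minimum of the distances `dHat j`. -/
def TubeDesign.d (D : TubeDesign task) (c : ℝ → E n) (t : ℝ) : ℝ :=
  -(1 / D.nu) * Real.log (∑ j, Real.exp (-D.nu * dHat task c j t))

/-- The radius `r` is positive, starts at the smooth minimum of `rmax` and `d 0`, and evolves by
the radius law, in which `d'` is the time derivative of `d`. -/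
structure TubeDesign.RadiusLaw (D : TubeDesign task) (c : ℝ → E n) (r : ℝ → ℝ) : Prop where
  pos : ∀ t, 0 ≤ t → 0 < r t
  init : r 0 = -(1 / D.nu) * Real.log (Real.exp (-D.nu * D.rmax) + Real.exp (-D.nu * D.d c 0))
  ode : ∀ t, 0 ≤ t → ∃ d' : ℝ, HasDerivWithinAt (D.d c) d' (Ici 0) t ∧
    HasDerivWithinAt r
      (Real.exp (-D.nu * D.d c t) * d' /
        (Real.exp (-D.nu * D.rmax) + Real.exp (-D.nu * D.d c t))) (Ici 0) t

end Task

/-- The tube at time `t`. -/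
def tube {n : ℕ} (c : ℝ → E n) (r : ℝ → ℝ) (t : ℝ) : Set (E n) := Metric.closedBall (c t) (r t)

/-! ## The control law -/

/-- The controller parameters: gains, and the constants of the funnels of the later stages (those
of block `0` are never used). -/
structure ControlParams (N n : ℕ) where
  kappa : Fin N → ℝ
  kappa_pos : ∀ k, 0 < kappa k
  p : Fin N → Fin n → ℝ
  q : Fin N → Fin n → ℝ
  mu : Fin N → Fin n → ℝ
  q_pos : ∀ k i, 0 < q k i
  q_lt_p : ∀ k i, q k i < p k i
  mu_nonneg : ∀ k i, 0 ≤ mu k i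

/-- The funnel `γ_{k,i}(t) = (p - q) exp(-μ t) + q`. -/
def ControlParams.funnel {N n : ℕ} (C : ControlParams N n) (k : Fin N) (i : Fin n) (t : ℝ) : ℝ :=
  (C.p k i - C.q k i) * Real.exp (-C.mu k i * t) + C.q k i

/-- The logarithmic error transformation. -/
def logErr (e : ℝ) : ℝ := Real.log ((1 + e) / (1 - e))

/-- The first reference signal `-κ ρ (x₁ - c)` with `ρ = logErr (‖x₁ - c‖ / r)`. -/
def firstControl {n : ℕ} (kappa : ℝ) (c : E n) (r : ℝ) (x1 : E n) : E n :=
  -(kappa * logErr (‖x1 - c‖ / r)) • (x1 - c)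

/-- The diagonal matrix `ξ = 4 diag(γ)⁻¹ (I - diag(e ∘ e))⁻¹`. -/
def xiMat {n : ℕ} (gam e : Fin n → ℝ) : Matrix (Fin n) (Fin n) ℝ :=
  Matrix.diagonal (fun i => 4 * (gam i)⁻¹ * (1 - e i * e i)⁻¹)

/-- The later reference signals `-κ ξ ρ`, as a function of the tracking error `z = x_k - r_k`, with
`e = diag(γ)⁻¹ z` and `ρ` the componentwise logarithmic transform of `e`. -/
def stageControl {n : ℕ} (kappa : ℝ) (gam : Fin n → ℝ) (z : E n) : E n :=
  -kappa • Matrix.toEuclideanLin (xiMat gam (fun i => z i / gam i))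
    (WithLp.toLp 2 (fun i => logErr (z i / gam i)))

/-- `ControlParams.ref C c r x t k hk` is the reference signal produced by block `k` (the reference
for block `k + 1`, or the input if `k` is the last block), at state `x` and time `t`. -/
def ControlParams.ref {N n : ℕ} (C : ControlParams N n) (c : ℝ → E n) (r : ℝ → ℝ)
    (x : Fin N → E n) (t : ℝ) : (k : ℕ) → k < N → E n
  | 0, hk => firstControl (C.kappa ⟨0, hk⟩) (c t) (r t) (x ⟨0, hk⟩)
  | k + 1, hk =>
      stageControl (C.kappa ⟨k + 1, hk⟩) (fun i => C.funnel ⟨k + 1, hk⟩ i t)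
        (x ⟨k + 1, hk⟩ - C.ref c r x t k (Nat.lt_of_succ_lt hk))

/-- The control input: the reference signal of the last block. -/
def ControlParams.input {N n : ℕ} (C : ControlParams N n) (hN : 0 < N) (c : ℝ → E n) (r : ℝ → ℝ)
    (x : Fin N → E n) (t : ℝ) : E n :=
  C.ref c r x t (N - 1) (Nat.sub_lt hN Nat.one_pos)

/-- The initial errors of the later stages lie inside the funnels. -/
def ControlParams.InitialErrors {N n : ℕ} (C : ControlParams N n) (c : ℝ → E n) (r : ℝ → ℝ)
    (x0 : Fin N → E n) : Prop :=
  ∀ (k : ℕ) (hk : k + 1 < N) (i : Fin n),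
    |(x0 ⟨k + 1, hk⟩ - C.ref c r x0 0 k (Nat.lt_of_succ_lt hk)) i| < C.p ⟨k + 1, hk⟩ i

end PrTRAS

end

open PrTRAS

open Filter Topology NNReal

/-! The proof has three ingredients: regularity of the tube, a priori bounds for the tracking
errors, and the geometry of the tube.

Regularity. A Gaussian vector gives spheres measure zero, so each avoidance probability `q` is
continuous along the centre. The denominators `q - eps` never vanish and are positive at late times,
hence always positive; the right-hand side of the centre law is therefore continuous in time and `c`
is locally Lipschitz. The radius law integrates exactly: `r` is the smooth minimum of `rmax` and `d`
(`RadiusLaw.eq_softmin`). The square root of the quantile is 1-Lipschitz in the standardized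
position of the centre, so `d` and `r` are locally Lipschitz too.

A priori bounds. The references and the disturbances need not yield differentiable errors, so each
error is written as `A + B`, with `A` a primitive of the term driven by the block's own reference
and `B` Lipschitz. As long as all errors are in their domains, the mismatch between the actual drive
and the reference is bounded by the next funnel. The feedback grows without bound towards the
boundary, and the symmetric part of `g` is uniformly positive, so a barrier level is never reached
(`stageBarrier_first`, `stageBarrier_later`). Induction along the cascade (`apriori_stages`) puts
all errors into compact subsets of the domains, uniformly over the trajectories on `[0, T]`. A
cut-off field has a global integral curve, and a continuation argument shows that it never meets the
cut-off (`exists_admissible`). Uniqueness is local Lipschitz continuity along that solution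
(`Admissible.eqOn`).

Geometry. From `r < rmax` the tube starts in `S`, and it ends in `T` because the cube-root law
brings `c` to `eta` in finite time. From `r ≤ d ≤ dHat` and the triangle inequality every point of
the tube avoids every obstacle with the required probability. -/

/-! ### Functions that are Lipschitz near a point -/

/-- `f` is Lipschitz on a neighbourhood of `p`. -/
def LipAt {α β : Type*} [PseudoMetricSpace α] [PseudoMetricSpace β] (f : α → β) (p : α) : Prop :=
  ∃ K : ℝ≥0, ∃ s ∈ 𝓝 p, LipschitzOnWith K f s

namespace LipAt

variable {α β γ : Type*} [PseudoMetricSpace α] [PseudoMetricSpace β] [PseudoMetricSpace γ]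
  {f : α → β} {p : α}

theorem of_lipschitzWith {K : ℝ≥0} (hf : LipschitzWith K f) : LipAt f p :=
  ⟨K, univ, univ_mem, hf.lipschitzOnWith⟩

theorem continuousAt (hf : LipAt f p) : ContinuousAt f p := by
  obtain ⟨K, s, hs, h⟩ := hf
  exact h.continuousOn.continuousAt hs

theorem const (b : β) : LipAt (fun _ : α => b) p := of_lipschitzWith (LipschitzWith.const b)

theorem fst {p : α × β} : LipAt (fun q : α × β => q.1) p := of_lipschitzWith LipschitzWith.prod_fst

theorem snd {p : α × β} : LipAt (fun q : α × β => q.2) p := of_lipschitzWith LipschitzWith.prod_snd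

theorem comp {g : β → γ} (hg : LipAt g (f p)) (hf : LipAt f p) : LipAt (fun x => g (f x)) p := by
  have hc := hf.continuousAt
  obtain ⟨K, s, hs, h⟩ := hf
  obtain ⟨K', s', hs', h'⟩ := hg
  exact ⟨K' * K, s ∩ f ⁻¹' s', inter_mem hs (hc hs'),
    h'.comp (h.mono inter_subset_left) fun x hx => hx.2⟩

theorem prodMk {g : α → γ} (hf : LipAt f p) (hg : LipAt g p) :
    LipAt (fun x => (f x, g x)) p := by
  obtain ⟨K, s, hs, h⟩ := hf
  obtain ⟨K', s', hs', h'⟩ := hg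
  exact ⟨max K K', s ∩ s', inter_mem hs hs',
    (h.mono inter_subset_left).prodMk (h'.mono inter_subset_right)⟩

theorem pi {ι : Type*} [Fintype ι] {δ : ι → Type*} [∀ i, PseudoMetricSpace (δ i)]
    {f : α → ∀ i, δ i} (hf : ∀ i, LipAt (fun x => f x i) p) : LipAt f p := by
  choose K s hs h using hf
  refine ⟨Finset.univ.sup K, ⋂ i, s i, iInter_mem.2 hs, ?_⟩
  refine LipschitzOnWith.of_dist_le_mul fun x hx y hy => ?_
  refine (dist_pi_le_iff (by positivity)).2 fun i => ?_
  refine ((h i).dist_le_mul x (mem_iInter.1 hx i) y (mem_iInter.1 hy i)).trans ?_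
  gcongr
  exact Finset.le_sup (f := K) (Finset.mem_univ i)

theorem congr {g : α → β} (hf : LipAt f p) (h : g =ᶠ[𝓝 p] f) : LipAt g p := by
  obtain ⟨K, s, hs, hK⟩ := hf
  refine ⟨K, s ∩ {x | g x = f x}, inter_mem hs h, fun x hx y hy => ?_⟩
  rw [hx.2, hy.2]
  exact hK hx.1 hy.1

theorem norm {V : Type*} [NormedAddCommGroup V] {f : α → V} (hf : LipAt f p) :
    LipAt (fun x => ‖f x‖) p :=
  comp (of_lipschitzWith lipschitzWith_one_norm) hf

section Normed

variable {V W : Type*} [NormedAddCommGroup V] [NormedSpace ℝ V] [NormedAddCommGroup W]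
  [NormedSpace ℝ W]

theorem of_contDiffAt {f : V → W} {p : V} (hf : ContDiffAt ℝ 1 f p) : LipAt f p :=
  hf.exists_lipschitzOnWith

theorem clm {f : α → V} (L : V →L[ℝ] W) (hf : LipAt f p) : LipAt (fun x => L (f x)) p :=
  comp (of_lipschitzWith L.lipschitz) hf

theorem add {f g : α → V} (hf : LipAt f p) (hg : LipAt g p) : LipAt (fun x => f x + g x) p :=
  comp (g := fun q : V × V => q.1 + q.2) (of_contDiffAt (by fun_prop)) (hf.prodMk hg)

theorem sub {f g : α → V} (hf : LipAt f p) (hg : LipAt g p) : LipAt (fun x => f x - g x) p :=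
  comp (g := fun q : V × V => q.1 - q.2) (of_contDiffAt (by fun_prop)) (hf.prodMk hg)

theorem neg {f : α → V} (hf : LipAt f p) : LipAt (fun x => -f x) p :=
  comp (g := fun q : V => -q) (of_contDiffAt (by fun_prop)) hf

theorem smul {a : α → ℝ} {f : α → V} (ha : LipAt a p) (hf : LipAt f p) :
    LipAt (fun x => a x • f x) p :=
  comp (g := fun q : ℝ × V => q.1 • q.2) (of_contDiffAt (by fun_prop)) (ha.prodMk hf)

theorem mul {a b : α → ℝ} (ha : LipAt a p) (hb : LipAt b p) : LipAt (fun x => a x * b x) p :=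
  ha.smul hb

theorem sum {ι : Type*} {s : Finset ι} {f : ι → α → V} (hf : ∀ i ∈ s, LipAt (f i) p) :
    LipAt (fun x => ∑ i ∈ s, f i x) p := by
  classical
  induction s using Finset.induction_on with
  | empty => simpa using const (0 : V)
  | insert i s hi ih =>
    simp only [Finset.sum_insert hi]
    exact (hf i (by simp)).add (ih fun j hj => hf j (by simp [hj]))

theorem inv {a : α → ℝ} (ha : LipAt a p) (h : a p ≠ 0) : LipAt (fun x => (a x)⁻¹) p :=
  comp (g := fun q : ℝ => q⁻¹) (of_contDiffAt (contDiffAt_inv ℝ h)) ha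

theorem div {a b : α → ℝ} (ha : LipAt a p) (hb : LipAt b p) (h : b p ≠ 0) :
    LipAt (fun x => a x / b x) p := by
  simpa only [div_eq_mul_inv] using ha.mul (hb.inv h)

theorem exp {a : α → ℝ} (ha : LipAt a p) : LipAt (fun x => Real.exp (a x)) p :=
  comp (of_contDiffAt Real.contDiff_exp.contDiffAt) ha

theorem log {a : α → ℝ} (ha : LipAt a p) (h : a p ≠ 0) : LipAt (fun x => Real.log (a x)) p :=
  comp (of_contDiffAt (Real.contDiffAt_log.2 h)) ha

end Normed

theorem euclidean_apply {n : ℕ} {f : α → E n} (hf : LipAt f p) (i : Fin n) :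
    LipAt (fun x => f x i) p :=
  hf.clm (EuclideanSpace.proj i : E n →L[ℝ] ℝ)

theorem euclidean {n : ℕ} {f : α → Fin n → ℝ} (hf : ∀ i, LipAt (fun x => f x i) p) :
    LipAt (fun x => (WithLp.toLp 2 (f x) : E n)) p :=
  (pi hf).clm ((EuclideanSpace.equiv (Fin n) ℝ).symm : (Fin n → ℝ) →L[ℝ] E n)

theorem exists_lipschitzOnWith_of_compact {S : Set α} (hS : IsCompact S)
    (hf : ∀ p ∈ S, LipAt f p) : ∃ K, LipschitzOnWith K f S :=
  LocallyLipschitzOn.exists_lipschitzOnWith_of_compact hS fun x hx => by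
    obtain ⟨K, t, ht, h⟩ := hf x hx
    exact ⟨K, t, mem_nhdsWithin_of_mem_nhds ht, h⟩

end LipAt

/-! ### Contact arguments for functions that are differentiable up to a Lipschitz error -/

/-- A continuous function that starts below `b` stays below `b`, if from each point where it is at
least `b` it does not decrease when one steps back a little. -/
theorem lt_of_no_first_contact {V : ℝ → ℝ} {τ b : ℝ} (hV : ContinuousOn V (Icc 0 τ))
    (h0 : V 0 < b) (h : ∀ t ∈ Ioc 0 τ, b ≤ V t → ∀ᶠ s in 𝓝[<] t, 0 ≤ s → V t ≤ V s) :
    ∀ t ∈ Icc 0 τ, V t < b := by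
  by_contra! hcon
  obtain ⟨t₀, ht₀, hb₀⟩ := hcon
  have hclosed : IsClosed (Icc 0 τ ∩ V ⁻¹' Ici b) :=
    hV.preimage_isClosed_of_isClosed isClosed_Icc isClosed_Ici
  have hcomp : IsCompact (Icc 0 τ ∩ V ⁻¹' Ici b) :=
    isCompact_Icc.of_isClosed_subset hclosed inter_subset_left
  -- At the least contact time, stepping back produces an earlier contact.
  obtain ⟨t, ⟨ht, htb⟩, hleast⟩ := hcomp.exists_isLeast ⟨t₀, ht₀, hb₀⟩
  have hpos : 0 < t := by
    rcases ht.1.eq_or_lt with h | h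
    · subst h; exact absurd htb (not_le.2 h0)
    · exact h
  obtain ⟨s, hs, hs'⟩ := ((h t ⟨hpos, ht.2⟩ htb).and (Ioo_mem_nhdsLT hpos)).exists
  have := hleast ⟨⟨hs'.1.le, hs'.2.le.trans ht.2⟩, (mem_Ici.1 htb).trans (hs hs'.1.le)⟩
  exact absurd this (not_le.2 hs'.2)

/-- If `z = A + B` with `A` differentiable and `B` Lipschitz with constant `M`, the increments of
`z` before `t`, tested against `η`, are bounded by any number above `⟪η, A'⟫ + M ‖η‖`. -/
theorem inner_increment_le {F : Type*} [NormedAddCommGroup F] [InnerProductSpace ℝ F]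
    {z A B η : ℝ → F} {A' η₀ : F} {t M b : ℝ} (hz : ∀ s ∈ Icc 0 t, z s = A s + B s) (ht : 0 < t)
    (hA : HasDerivAt A A' t) (hB : ∀ s ∈ Icc 0 t, ‖B t - B s‖ ≤ M * |t - s|)
    (hη : Tendsto η (𝓝[<] t) (𝓝 η₀)) (hb : inner ℝ η₀ A' + M * ‖η₀‖ < b) :
    ∀ᶠ s in 𝓝[<] t, inner ℝ (η s) (z t - z s) ≤ b * (t - s) := by
  have hslope : Tendsto (slope A t) (𝓝[<] t) (𝓝 A') :=
    (hasDerivAt_iff_tendsto_slope.1 hA).mono_left (nhdsWithin_mono _ fun s hs => ne_of_lt hs)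
  -- The test vector may vary with `s`: the later stages use a gradient weighted by the funnel
  -- widths at time `s`.
  have hlim : Tendsto (fun s => inner ℝ (η s) (slope A t s) + M * ‖η s‖) (𝓝[<] t)
      (𝓝 (inner ℝ η₀ A' + M * ‖η₀‖)) :=
    (hη.inner hslope).add (hη.norm.const_mul M)
  filter_upwards [hlim.eventually_lt_const hb, Ioo_mem_nhdsLT ht] with s hs hs'
  have hts : 0 < t - s := sub_pos.2 hs'.2
  have hmem : s ∈ Icc 0 t := ⟨hs'.1.le, hs'.2.le⟩
  have hAs : A t - A s = (t - s) • slope A t s := by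
    have := sub_smul_slope A t s
    rw [vsub_eq_sub] at this
    rw [← neg_sub (A s), ← this, ← neg_smul, neg_sub]
  have hzs : z t - z s = (t - s) • slope A t s + (B t - B s) := by
    rw [hz t ⟨ht.le, le_rfl⟩, hz s hmem, ← hAs]; abel
  rw [hzs, inner_add_right, inner_smul_right]
  have h1 : inner ℝ (η s) (B t - B s) ≤ ‖η s‖ * (M * (t - s)) := by
    refine (real_inner_le_norm _ _).trans ?_
    gcongr
    simpa [abs_of_pos hts] using hB s hmem
  nlinarith [mul_le_mul_of_nonneg_left hs.le hts.le]

/-! ### The logarithmic error transformation -/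

theorem hasDerivAt_logErr {e : ℝ} (he : e ∈ Ioo (-1 : ℝ) 1) :
    HasDerivAt logErr (2 / (1 - e ^ 2)) e := by
  have h1 : 1 - e ≠ 0 := by linarith [he.2]
  have h2 : 1 + e ≠ 0 := by linarith [he.1]
  have h3 : 1 - e ^ 2 ≠ 0 := by
    rw [show 1 - e ^ 2 = (1 - e) * (1 + e) by ring]; exact mul_ne_zero h1 h2
  have hd : HasDerivAt (fun x : ℝ => (1 + x) / (1 - x))
      ((1 * (1 - e) - (1 + e) * (-1)) / (1 - e) ^ 2) e :=
    ((hasDerivAt_id e).const_add 1).div ((hasDerivAt_id e).const_sub 1) h1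
  have := hd.log (div_ne_zero h2 h1)
  refine this.congr_deriv ?_
  field_simp
  ring

theorem lipAt_logErr {e : ℝ} (he : e ∈ Ioo (-1 : ℝ) 1) : LipAt logErr e := by
  have h1 : 1 - e ≠ 0 := by linarith [he.2]
  have h2 : 1 + e ≠ 0 := by linarith [he.1]
  refine LipAt.of_contDiffAt ?_
  exact ((contDiffAt_const.add contDiffAt_id).div (contDiffAt_const.sub contDiffAt_id) h1).log
    (div_ne_zero h2 h1)

theorem logErr_zero : logErr 0 = 0 := by simp [logErr]

theorem logErr_neg (e : ℝ) : logErr (-e) = -logErr e := by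
  rw [logErr, logErr, ← Real.log_inv, inv_div, sub_neg_eq_add, ← sub_eq_add_neg]

theorem strictMonoOn_logErr : StrictMonoOn logErr (Ioo (-1) 1) := by
  refine strictMonoOn_of_deriv_pos (convex_Ioo _ _)
    (fun e he => (hasDerivAt_logErr he).continuousAt.continuousWithinAt) fun e he => ?_
  rw [interior_Ioo] at he
  rw [(hasDerivAt_logErr he).deriv]
  have : 0 < 1 - e ^ 2 := by nlinarith [he.1, he.2]
  positivity

theorem logErr_abs (e : ℝ) : logErr |e| = |logErr e| ∨ 1 ≤ |e| := by
  rcases le_or_gt 1 |e| with h | h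
  · exact Or.inr h
  refine Or.inl ?_
  rw [abs_lt] at h
  rcases le_total 0 e with h0 | h0
  · rw [abs_of_nonneg h0, abs_of_nonneg]
    rw [← logErr_zero]
    exact strictMonoOn_logErr.monotoneOn (by norm_num) h h0
  · rw [abs_of_nonpos h0, logErr_neg, abs_of_nonpos]
    rw [← logErr_zero]
    exact strictMonoOn_logErr.monotoneOn h (by norm_num) h0

theorem abs_le_of_abs_logErr_le {e a : ℝ} (he : |e| < 1) (ha : a ∈ Ioo (0 : ℝ) 1)
    (h : |logErr e| ≤ logErr a) : |e| ≤ a := by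
  have h1 := (logErr_abs e).resolve_right (not_le.2 he)
  rw [← h1] at h
  exact (strictMonoOn_logErr.le_iff_le ⟨by linarith [abs_nonneg e], he⟩
    ⟨by linarith [ha.1], ha.2⟩).1 h

theorem mul_logErr_nonneg {e : ℝ} (he : e ∈ Ioo (-1 : ℝ) 1) : 0 ≤ e * logErr e := by
  rcases le_total 0 e with h0 | h0
  · refine mul_nonneg h0 ?_
    rw [← logErr_zero]
    exact strictMonoOn_logErr.monotoneOn (by norm_num) he h0
  · refine mul_nonneg_of_nonpos_of_nonpos h0 ?_
    rw [← logErr_zero]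
    exact strictMonoOn_logErr.monotoneOn he (by norm_num) h0

theorem tendsto_logErr_atTop : Tendsto logErr (𝓝[<] 1) atTop := by
  have h1 : Tendsto (fun e : ℝ => 1 - e) (𝓝[<] 1) (𝓝[>] 0) := by
    refine tendsto_nhdsWithin_iff.2 ⟨?_, ?_⟩
    · exact ((continuous_const.sub continuous_id).tendsto' 1 0 (by simp)).mono_left
        nhdsWithin_le_nhds
    · filter_upwards [self_mem_nhdsWithin] with e he using sub_pos.2 (mem_Iio.1 he)
  have h2 : Tendsto (fun e : ℝ => 1 + e) (𝓝[<] 1) (𝓝 2) :=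
    ((continuous_const.add continuous_id).tendsto' 1 2 (by norm_num)).mono_left
      nhdsWithin_le_nhds
  refine Real.tendsto_log_atTop.comp ?_
  simp only [div_eq_mul_inv]
  exact h2.pos_mul_atTop two_pos (tendsto_inv_nhdsGT_zero.comp h1)

/-- There are arguments in `(a, 1)` at which the transformed error exceeds any given value. -/
theorem exists_logErr_gt (Λ : ℝ) {a : ℝ} (ha : a < 1) : ∃ e ∈ Ioo a 1, Λ < logErr e := by
  obtain ⟨e, he, he'⟩ :=
    ((tendsto_logErr_atTop.eventually_gt_atTop Λ).and (Ioo_mem_nhdsLT ha)).exists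
  exact ⟨e, he', he⟩

/-- The second derivative is `4 (1 + e logErr e) / (1 - e²)²`, and `logErr e` has the sign of `e`.
-/
theorem convexOn_sq_logErr : ConvexOn ℝ (Ioo (-1) 1) fun e => logErr e ^ 2 / 2 := by
  have hd1 : ∀ e ∈ Ioo (-1 : ℝ) 1,
      HasDerivAt (fun e => logErr e ^ 2 / 2) (logErr e * (2 / (1 - e ^ 2))) e := fun e he =>
    (((hasDerivAt_logErr he).pow 2).div_const 2).congr_deriv (by simp; ring)
  have hd2 : ∀ e ∈ Ioo (-1 : ℝ) 1, HasDerivAt (fun e => logErr e * (2 / (1 - e ^ 2)))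
      (4 * (1 + e * logErr e) / (1 - e ^ 2) ^ 2) e := by
    intro e he
    have h3 : 1 - e ^ 2 ≠ 0 := by nlinarith [he.1, he.2]
    have h4 : HasDerivAt (fun e : ℝ => 2 / (1 - e ^ 2))
        ((0 * (1 - e ^ 2) - 2 * (-(2 * e))) / (1 - e ^ 2) ^ 2) e := by
      refine (hasDerivAt_const e (2 : ℝ)).div ?_ h3
      have := ((hasDerivAt_id e).pow 2).const_sub 1
      refine this.congr_deriv ?_
      simp
    refine ((hasDerivAt_logErr he).mul h4).congr_deriv ?_
    field_simp
    ring
  refine convexOn_of_hasDerivWithinAt2_nonneg (convex_Ioo _ _)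
    (f' := fun e => logErr e * (2 / (1 - e ^ 2)))
    (f'' := fun e => 4 * (1 + e * logErr e) / (1 - e ^ 2) ^ 2)
    (fun e he => (hd1 e he).continuousAt.continuousWithinAt) ?_ ?_ ?_
  · intro e he
    rw [interior_Ioo] at he
    exact (hd1 e he).hasDerivWithinAt
  · intro e he
    rw [interior_Ioo] at he
    exact (hd2 e he).hasDerivWithinAt
  · intro e he
    rw [interior_Ioo] at he
    have := mul_logErr_nonneg he
    positivity

/-- Convexity bounds barrier increments by the gradient at one endpoint, without remainder. This
replaces the chain rule along trajectories that need not be differentiable. -/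
theorem sq_logErr_tangent {a b : ℝ} (ha : a ∈ Ioo (-1 : ℝ) 1) (hb : b ∈ Ioo (-1 : ℝ) 1) :
    logErr a ^ 2 / 2 - logErr b ^ 2 / 2 ≤ logErr a * (2 / (1 - a ^ 2)) * (a - b) := by
  have hd : HasDerivAt (fun e => logErr e ^ 2 / 2) (logErr a * (2 / (1 - a ^ 2))) a :=
    (((hasDerivAt_logErr ha).pow 2).div_const 2).congr_deriv (by simp; ring)
  rcases lt_trichotomy a b with h | h | h
  · have := convexOn_sq_logErr.le_slope_of_hasDerivAt ha hb h hd
    rw [slope_def_field, le_div_iff₀ (sub_pos.2 h)] at this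
    linarith
  · subst h; simp
  · have := convexOn_sq_logErr.slope_le_of_hasDerivAt hb ha h hd
    rw [slope_def_field, div_le_iff₀ (sub_pos.2 h)] at this
    linarith

/-! ### Matrices with positive definite symmetric part -/

theorem inner_toEuclideanLin_symPart {n : ℕ} (A : Matrix (Fin n) (Fin n) ℝ) (y : E n) :
    inner ℝ y (Matrix.toEuclideanLin (symPart A) y) = inner ℝ y (Matrix.toEuclideanLin A y) := by
  have h : inner ℝ y (Matrix.toEuclideanLin A.transpose y)
      = inner ℝ y (Matrix.toEuclideanLin A y) := by
    have := Matrix.toEuclideanLin_conjTranspose_eq_adjoint A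
    rw [Matrix.conjTranspose_eq_transpose_of_trivial] at this
    rw [this, LinearMap.adjoint_inner_right, real_inner_comm]
  rw [symPart, map_smul, map_add, LinearMap.smul_apply, LinearMap.add_apply, inner_smul_right,
    inner_add_right, h]
  ring

/-- The antisymmetric part drops out of the quadratic form, and the rest is expanded in an
orthonormal eigenbasis. The barrier arguments use the eigenvalue hypothesis only in this form. -/
theorem le_inner_toEuclideanLin {n : ℕ} {A : Matrix (Fin n) (Fin n) ℝ} {glow : ℝ}
    (h : ∀ a, glow ≤ (symPart_isHermitian A).eigenvalues a) (y : E n) :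
    glow * ‖y‖ ^ 2 ≤ inner ℝ y (Matrix.toEuclideanLin A y) := by
  rw [← inner_toEuclideanLin_symPart]
  set H := symPart_isHermitian A
  have hsym := Matrix.isSymmetric_toEuclideanLin_iff.mpr H
  set b := H.eigenvectorBasis
  have hb : ∀ i, Matrix.toEuclideanLin (symPart A) (b i) = H.eigenvalues i • b i := fun i => by
    ext j
    have := congrFun (H.mulVec_eigenvectorBasis i) j
    simpa [Matrix.toLpLin_apply] using this
  rw [← b.sum_inner_mul_inner y (Matrix.toEuclideanLin (symPart A) y),
    ← b.sum_sq_norm_inner_right y, Finset.mul_sum]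
  refine Finset.sum_le_sum fun i _ => ?_
  rw [← hsym (b i) y, hb, inner_smul_left, real_inner_comm y (b i), Real.norm_eq_abs, sq_abs]
  simp only [conj_trivial]
  nlinarith [mul_le_mul_of_nonneg_right (h i) (sq_nonneg (inner ℝ y (b i)))]

/-! ### Invariance of one stage -/

/-- The feedback `ctrl` keeps trajectories that are driven by it, up to a Lipschitz perturbation,
inside a compact part of `dom` that depends only on the constants and the initial value. -/
def StageBarrier {n : ℕ} (ctrl : ℝ → E n → E n) (dom : Set (ℝ × E n)) (T : ℝ) : Prop :=
  ∀ M glow : ℝ, 0 ≤ M → 0 < glow → ∀ z₀ : E n, (0, z₀) ∈ dom →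
    ∃ S ⊆ dom, IsCompact S ∧ ∀ τ ∈ Icc 0 T, ∀ (z A B : ℝ → E n) (G : ℝ → E n →ₗ[ℝ] E n),
      (∀ t ∈ Icc 0 τ, z t = A t + B t) → ContinuousOn z (Icc 0 τ) → z 0 = z₀ →
      (∀ t ∈ Icc 0 τ, (t, z t) ∈ dom) →
      (∀ t ∈ Icc 0 τ, ∀ y, glow * ‖y‖ ^ 2 ≤ inner ℝ y (G t y)) →
      (∀ t ∈ Ioc 0 τ, HasDerivAt A (G t (ctrl t (z t))) t) →
      (∀ t ∈ Icc 0 τ, ∀ s ∈ Icc 0 t, ‖B t - B s‖ ≤ M * |t - s|) →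
      ∀ t ∈ Icc 0 τ, (t, z t) ∈ S

/-- Where `‖z‖ ≥ a r`, the feedback pushes inwards at speed at least `kappa * logErr a * glow *
‖z‖`. For `a` close to `1` this beats the perturbation rate `M` together with the shrinking rate `L`
of the tube, so the level `‖z‖ = a r` is not reached. -/
theorem stageBarrier_first {n : ℕ} {r : ℝ → ℝ} (hr : LocallyLipschitz r) (hpos : ∀ t, 0 < r t)
    {kappa : ℝ} (hk : 0 < kappa) (T : ℝ) :
    StageBarrier (fun t z => firstControl kappa (0 : E n) (r t) z) {p | ‖p.2‖ < r p.1} T := by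
  intro M glow hM hglow z₀ hz₀
  obtain ⟨L, hL⟩ := LipAt.exists_lipschitzOnWith_of_compact (isCompact_Icc (a := (0 : ℝ)) (b := T))
    fun t _ => hr t
  rcases lt_or_ge T 0 with hT | hT
  · exact ⟨∅, empty_subset _, isCompact_empty, fun τ hτ => absurd (hτ.1.trans hτ.2) (not_le.2 hT)⟩
  obtain ⟨tlo, _, hlo⟩ := (isCompact_Icc (a := (0 : ℝ)) (b := T)).exists_isMinOn ⟨0, le_rfl, hT⟩
    hr.continuous.continuousOn
  obtain ⟨thi, _, hhi⟩ := (isCompact_Icc (a := (0 : ℝ)) (b := T)).exists_isMaxOn ⟨0, le_rfl, hT⟩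
    hr.continuous.continuousOn
  have hrlo := hpos tlo
  have hz₀' : ‖z₀‖ / r 0 < 1 := (div_lt_one (hpos 0)).2 hz₀
  -- The level `a` lies above the initial ratio, and above `1/2` so that `‖z‖ ≥ r tlo / 2` at a
  -- contact; the factor `2` in the threshold pays for that `1/2`.
  obtain ⟨a, ha, hlog⟩ := exists_logErr_gt (max 0 (2 * (M + L) / (kappa * glow * r tlo)))
    (max_lt (by norm_num : (1 / 2 : ℝ) < 1) hz₀')
  have ha2 : 1 / 2 < a := (le_max_left _ _).trans_lt ha.1
  have haz : ‖z₀‖ / r 0 < a := (le_max_right _ _).trans_lt ha.1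
  have hloga := (le_max_left _ _).trans_lt hlog
  have hlogb := (le_max_right _ _).trans_lt hlog
  refine ⟨{p | p.1 ∈ Icc 0 T ∧ ‖p.2‖ ≤ a * r p.1}, fun p hp => ?_, ?_, ?_⟩
  · exact lt_of_le_of_lt hp.2 (by nlinarith [hpos p.1, ha.2])
  · refine (isCompact_Icc.prod (isCompact_closedBall (0 : E n) (r thi))).of_isClosed_subset
      (s := Icc 0 T ×ˢ Metric.closedBall (0 : E n) (r thi)) ?_ fun p hp => ⟨hp.1, ?_⟩
    · exact (isClosed_Icc.preimage continuous_fst).inter (isClosed_le continuous_snd.norm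
        (continuous_const.mul (hr.continuous.comp continuous_fst)))
    · rw [mem_closedBall_zero_iff]
      have h1 : r p.1 ≤ r thi := hhi hp.1
      exact hp.2.trans (by nlinarith [hpos p.1, ha.2])
  intro τ hτ z A B G hz hzc hzi hdom hG hA hB
  suffices h : ∀ t ∈ Icc 0 τ, ‖z t‖ - a * r t < 0 from fun t ht =>
    ⟨⟨ht.1, ht.2.trans hτ.2⟩, by linarith [h t ht]⟩
  refine lt_of_no_first_contact
    (hzc.norm.sub (continuousOn_const.mul hr.continuous.continuousOn)) ?_ fun t ht hV => ?_
  · rw [hzi, sub_neg]; exact (div_lt_iff₀ (hpos 0)).1 haz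
  have htτ : t ∈ Icc 0 τ := ⟨ht.1.le, ht.2⟩
  have htT : t ∈ Icc 0 T := ⟨ht.1.le, ht.2.trans hτ.2⟩
  have hrt : r tlo ≤ r t := hlo htT
  have hzlow : r tlo / 2 ≤ ‖z t‖ := by nlinarith
  have hzpos : 0 < ‖z t‖ := by linarith
  have hea : a ≤ ‖z t‖ / r t := (le_div_iff₀ (hpos t)).2 (by linarith)
  have he1 : ‖z t‖ / r t < 1 := (div_lt_one (hpos t)).2 (hdom t htτ)
  have hle : logErr a ≤ logErr (‖z t‖ / r t) :=
    strictMonoOn_logErr.monotoneOn ⟨by linarith, ha.2⟩ ⟨by linarith, he1⟩ hea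
  set l := logErr (‖z t‖ / r t)
  have hctrl : firstControl kappa (0 : E n) (r t) (z t) = -(kappa * l) • z t := by
    simp only [firstControl, sub_zero, l]
  -- The bound is `-(‖z t‖ * L)` rather than `0`, to outpace a tube that shrinks at rate up to `L`.
  have hkey : inner ℝ (z t) (G t (firstControl kappa (0 : E n) (r t) (z t))) + M * ‖z t‖
      < -(‖z t‖ * L) := by
    rw [hctrl, map_smul, inner_smul_right]
    have h1 := hG t htτ (z t)
    have hl0 : 0 < l := hloga.trans_le hle
    have h2 : M + L < kappa * l * glow * ‖z t‖ := by
      rw [div_lt_iff₀ (by positivity)] at hlogb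
      have h3 : logErr a * (kappa * glow * r tlo) ≤ l * (kappa * glow * (2 * ‖z t‖)) := by
        gcongr; linarith
      linarith
    have h4 := mul_le_mul_of_nonneg_left h1 (by positivity : 0 ≤ kappa * l)
    nlinarith
  filter_upwards [inner_increment_le (η := fun _ => z t)
    (fun s hs => hz s ⟨hs.1, hs.2.trans ht.2⟩) ht.1 (hA t ht) (hB t htτ)
    tendsto_const_nhds hkey, self_mem_nhdsWithin] with s hs hst hs0
  have hst' : 0 < t - s := sub_pos.2 hst
  have hr1 : -(L * (t - s)) ≤ r t - r s := by
    have := hL.dist_le_mul t htT s ⟨hs0, (mem_Iio.1 hst).le.trans htT.2⟩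
    rw [Real.dist_eq, Real.dist_eq, abs_of_pos hst'] at this
    linarith [neg_abs_le (r t - r s)]
  -- Cauchy–Schwarz turns the increment tested against `z t` into an increment of the norm.
  have h5 : ‖z t‖ * (‖z t‖ - ‖z s‖) ≤ ‖z t‖ * (-(L * (t - s))) := by
    have := real_inner_le_norm (z t) (z s)
    rw [inner_sub_right, real_inner_self_eq_norm_sq] at hs
    nlinarith
  have h6 := le_of_mul_le_mul_left h5 hzpos
  have h7 : -(L * (t - s)) ≤ a * -(L * (t - s)) := by
    have : 0 ≤ (L : ℝ) * (t - s) := by positivity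
    nlinarith [ha.2]
  nlinarith

theorem norm_le_sum_abs {n : ℕ} (z : E n) : ‖z‖ ≤ ∑ i, |z i| := by
  conv_lhs => rw [← (EuclideanSpace.basisFun (Fin n) ℝ).sum_repr z]
  refine (norm_sum_le _ _).trans (le_of_eq (Finset.sum_congr rfl fun i _ => ?_))
  simp [norm_smul]

/-- The gradient of `∑ i, logErr (z i / γ i) ^ 2 / 2` with respect to `z`. -/
noncomputable def barrierGrad {n : ℕ} (gam : Fin n → ℝ) (e : Fin n → ℝ) : E n :=
  WithLp.toLp 2 fun i => logErr (e i) * (2 / (1 - e i ^ 2)) / gam i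

/-- The factor `4` in `xiMat` makes the feedback a multiple of the negative barrier gradient. Tested
against that gradient it gives a quadratic form in the gradient, to which the lower bound `glow`
applies. -/
theorem stageControl_eq {n : ℕ} (kappa : ℝ) (gam : Fin n → ℝ) (z : E n) :
    stageControl kappa gam z = (-(2 * kappa)) • barrierGrad gam (fun i => z i / gam i) := by
  ext i
  simp only [stageControl, barrierGrad, xiMat, PiLp.smul_apply, Matrix.toLpLin_apply,
    Matrix.mulVec_diagonal, smul_eq_mul]
  field_simp
  ring

/-- The barrier is `∑ logErr (z i / γ i)² / 2`, with gradient `η`. Its decrease is at least `2 *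
kappa * glow * ‖η‖²`, while perturbation and funnel motion contribute at most `M' * ‖η‖`. Since
`‖η‖` is large where the barrier is large, a sufficiently high level `b` is never reached. -/
theorem stageBarrier_later {n : ℕ} {gam : Fin n → ℝ → ℝ} (hgam : ∀ i, LocallyLipschitz (gam i))
    (hpos : ∀ i t, 0 < gam i t) {kappa : ℝ} (hk : 0 < kappa) (T : ℝ) :
    StageBarrier (fun t (z : E n) => stageControl kappa (fun i => gam i t) z)
      {p | ∀ i, |p.2 i| < gam i p.1} T := by
  intro M glow hM hglow z₀ hz₀
  rcases lt_or_ge T 0 with hT | hT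
  · exact ⟨∅, empty_subset _, isCompact_empty, fun τ hτ => absurd (hτ.1.trans hτ.2) (not_le.2 hT)⟩
  have hgc : ∀ i, Continuous (gam i) := fun i => (hgam i).continuous
  choose L hL using fun i => LipAt.exists_lipschitzOnWith_of_compact
    (isCompact_Icc (a := (0 : ℝ)) (b := T)) fun t _ => hgam i t
  have hbd : ∃ P : ℝ, 0 < P ∧ ∀ i, ∀ t ∈ Icc 0 T, gam i t ≤ P := by
    choose P hP using fun i =>
      (isCompact_Icc (a := (0 : ℝ)) (b := T)).exists_bound_of_continuousOn (hgc i).continuousOn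
    refine ⟨1 + ∑ i, |P i|, by positivity, fun i t ht => ?_⟩
    have h1 := (le_abs_self _).trans ((hP i t ht).trans (le_abs_self _))
    have h2 := Finset.single_le_sum (f := fun i => |P i|) (fun i _ => abs_nonneg _)
      (Finset.mem_univ i)
    linarith
  obtain ⟨P, hP, hgP⟩ := hbd
  set M' : ℝ := M + ∑ i, (L i : ℝ)
  have hM' : 0 ≤ M' := by positivity
  set W : (Fin n → ℝ) → ℝ := fun e => ∑ i, logErr (e i) ^ 2 / 2
  -- On the level `b` one has `‖η‖² ≥ 8 b / P²`, so the second condition says `‖η‖ > M' / (2 * kappa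
  -- * glow)`.
  obtain ⟨b, hb1, hb2⟩ : ∃ b, W (fun i => z₀ i / gam i 0) < b ∧
      (M' / (2 * kappa * glow)) ^ 2 < 8 * b / P ^ 2 := by
    refine ⟨max (W (fun i => z₀ i / gam i 0)) ((M' / (2 * kappa * glow)) ^ 2 * P ^ 2 / 8) + 1,
      (le_max_left _ _).trans_lt (lt_add_one _), ?_⟩
    rw [lt_div_iff₀ (by positivity)]
    have := le_max_right (W (fun i => z₀ i / gam i 0)) ((M' / (2 * kappa * glow)) ^ 2 * P ^ 2 / 8)
    linarith
  -- A barrier value below `b` forces `|logErr (e i)| ≤ √(2b)` for each `i`, hence `|e i| ≤ a`.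
  obtain ⟨a, ha, hlog⟩ := exists_logErr_gt (Real.sqrt (2 * b)) (zero_lt_one (α := ℝ))
  refine ⟨{p | p.1 ∈ Icc 0 T ∧ ∀ i, |p.2 i| ≤ a * gam i p.1}, fun p hp i => ?_, ?_, ?_⟩
  · exact lt_of_le_of_lt (hp.2 i) (by nlinarith [hpos i p.1, ha.2])
  · refine (isCompact_Icc.prod
      (isCompact_closedBall (0 : E n) (∑ _i : Fin n, P))).of_isClosed_subset
      (s := Icc 0 T ×ˢ Metric.closedBall (0 : E n) (∑ _i : Fin n, P)) ?_ fun p hp => ⟨hp.1, ?_⟩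
    · refine (isClosed_Icc.preimage continuous_fst).inter ?_
      change IsClosed {p : ℝ × E n | ∀ i, |p.2 i| ≤ a * gam i p.1}
      rw [ofPred_forall]
      exact isClosed_iInter fun i => isClosed_le
        ((EuclideanSpace.proj i : E n →L[ℝ] ℝ).continuous.comp continuous_snd).abs
        (continuous_const.mul ((hgc i).comp continuous_fst))
    · rw [mem_closedBall_zero_iff]
      refine (norm_le_sum_abs p.2).trans (Finset.sum_le_sum fun i _ => (hp.2 i).trans ?_)
      nlinarith [hpos i p.1, ha.2, hgP i p.1 hp.1]
  intro τ hτ z A B G hz hzc hzi hdom hG hA hB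
  set e : ℝ → Fin n → ℝ := fun t i => z t i / gam i t
  have he : ∀ t ∈ Icc 0 τ, ∀ i, |e t i| < 1 := fun t ht i => by
    simp only [e]
    rw [abs_div, abs_of_pos (hpos i t), div_lt_one (hpos i t)]
    exact hdom t ht i
  have he' : ∀ t ∈ Icc 0 τ, ∀ i, e t i ∈ Ioo (-1 : ℝ) 1 := fun t ht i => abs_lt.1 (he t ht i)
  have hec : ∀ i, ContinuousOn (fun t => e t i) (Icc 0 τ) := fun i =>
    ((EuclideanSpace.proj i : E n →L[ℝ] ℝ).continuous.comp_continuousOn hzc).div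
      (hgc i).continuousOn fun t _ => (hpos i t).ne'
  suffices h : ∀ t ∈ Icc 0 τ, W (e t) < b from fun t ht => by
    refine ⟨⟨ht.1, ht.2.trans hτ.2⟩, fun i => ?_⟩
    have h1 : logErr (e t i) ^ 2 / 2 ≤ W (e t) :=
      Finset.single_le_sum (f := fun i => logErr (e t i) ^ 2 / 2) (fun i _ => by positivity)
        (Finset.mem_univ i)
    have h2 : |logErr (e t i)| ≤ logErr a :=
      (Real.abs_le_sqrt (by linarith [h t ht])).trans hlog.le
    have h3 := abs_le_of_abs_logErr_le (he t ht i) ha h2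
    simp only [e] at h3
    rwa [abs_div, abs_of_pos (hpos i t), div_le_iff₀ (hpos i t)] at h3
  refine lt_of_no_first_contact ?_ ?_ fun t ht hV => ?_
  · refine continuousOn_finsetSum _ fun i _ => ContinuousOn.div_const (ContinuousOn.pow ?_ 2) 2
    exact fun t ht => ContinuousAt.comp_continuousWithinAt
      (f := fun t => e t i) (lipAt_logErr (he' t ht i)).continuousAt (hec i t ht)
  · simpa only [e, hzi] using hb1
  have htτ : t ∈ Icc 0 τ := ⟨ht.1.le, ht.2⟩
  have htT : t ∈ Icc 0 T := ⟨ht.1.le, ht.2.trans hτ.2⟩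
  -- Errors are frozen at `t` but funnel widths are taken at `s`. With `D s = γ(s) e(t)` one has `z
  -- s - D s = γ(s) (e(s) - e(t))`, so the widths cancel and the tangent bound between `e t` and `e
  -- s` is exactly the increment of `z - D` tested against `η s`.
  set η : ℝ → E n := fun s => barrierGrad (fun i => gam i s) (e t)
  have hη : Tendsto η (𝓝[<] t) (𝓝 (η t)) := by
    refine Tendsto.mono_left ?_ nhdsWithin_le_nhds
    have : ContinuousAt η t := by
      refine (PiLp.continuous_toLp 2 _).continuousAt.comp (continuousAt_pi.2 fun i => ?_)
      exact continuousAt_const.div (hgc i).continuousAt (hpos i t).ne'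
    exact this
  -- `z - γ e(t)` has the same structure as `z`, with a larger Lipschitz constant.
  set D : ℝ → E n := fun s => WithLp.toLp 2 fun i => e t i * gam i s
  have hD : ∀ s ∈ Icc 0 t, ‖D t - D s‖ ≤ (∑ i, (L i : ℝ)) * |t - s| := by
    intro s hs
    refine (norm_le_sum_abs _).trans ?_
    rw [Finset.sum_mul]
    refine Finset.sum_le_sum fun i _ => ?_
    have h1 := (hL i).dist_le_mul t htT s ⟨hs.1, hs.2.trans htT.2⟩
    rw [Real.dist_eq, Real.dist_eq] at h1
    have h2 : (D t - D s) i = e t i * (gam i t - gam i s) := by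
      simp only [D, PiLp.sub_apply]; ring
    rw [h2, abs_mul]
    nlinarith [he t htτ i, abs_nonneg (e t i), abs_nonneg (gam i t - gam i s)]
  have hkey : inner ℝ (η t) (G t (stageControl kappa (fun i => gam i t) (z t))) + M' * ‖η t‖
      < 0 := by
    have h0 : stageControl kappa (fun i => gam i t) (z t) = (-(2 * kappa)) • η t :=
      stageControl_eq _ _ _
    rw [h0, map_smul, inner_smul_right]
    have h1 := hG t htτ (η t)
    -- Each gradient entry is at least `2 |logErr (e i)| / P` in absolute value, because `1 - e i² ≤
    -- 1` and `γ i ≤ P`.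
    have h2 : 8 * b / P ^ 2 ≤ ‖η t‖ ^ 2 := by
      rw [EuclideanSpace.real_norm_sq_eq, div_le_iff₀ (by positivity), Finset.sum_mul]
      refine (mul_le_mul_of_nonneg_left hV (by norm_num)).trans ?_
      simp only [W]
      rw [Finset.mul_sum]
      refine Finset.sum_le_sum fun i _ => ?_
      have h3 : 0 < 1 - e t i ^ 2 := by nlinarith [(he' t htτ i).1, (he' t htτ i).2]
      have h4 : (1 : ℝ) ≤ 1 / (1 - e t i ^ 2) :=
        (one_le_div h3).2 (by linarith [sq_nonneg (e t i)])
      have h5 : (1 : ℝ) ≤ P / gam i t := (one_le_div (hpos i t)).2 (hgP i t htT)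
      have h6 : (1 : ℝ) ≤ (1 / (1 - e t i ^ 2)) * (P / gam i t) :=
        one_le_mul_of_one_le_of_one_le h4 h5
      have h7 : 1 ≤ ((1 / (1 - e t i ^ 2)) * (P / gam i t)) ^ 2 := one_le_pow₀ h6
      calc 8 * (logErr (e t i) ^ 2 / 2) = 4 * logErr (e t i) ^ 2 * 1 := by ring
        _ ≤ 4 * logErr (e t i) ^ 2 * ((1 / (1 - e t i ^ 2)) * (P / gam i t)) ^ 2 := by gcongr
        _ = _ := by simp only [η, barrierGrad]; ring
    have h3 : M' / (2 * kappa * glow) < ‖η t‖ := lt_of_pow_lt_pow_left₀ 2 (norm_nonneg _)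
      (hb2.trans_le h2)
    rw [div_lt_iff₀ (by positivity)] at h3
    have h4 : 0 < ‖η t‖ := by
      rcases (norm_nonneg (η t)).eq_or_lt with h | h
      · rw [← h] at h3; linarith
      · exact h
    nlinarith
  have hBD : ∀ s ∈ Icc 0 t, ‖B t - D t - (B s - D s)‖ ≤ M' * |t - s| := fun s hs => by
    have h1 := hB t htτ s hs
    have h2 := hD s hs
    calc ‖B t - D t - (B s - D s)‖ = ‖(B t - B s) - (D t - D s)‖ := by congr 1; abel
      _ ≤ ‖B t - B s‖ + ‖D t - D s‖ := norm_sub_le _ _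
      _ ≤ M' * |t - s| := by simp only [M']; linarith
  filter_upwards [inner_increment_le (z := fun s => z s - D s) (B := fun s => B s - D s)
    (fun s hs => by simp only [hz s ⟨hs.1, hs.2.trans ht.2⟩, add_sub_assoc]) ht.1 (hA t ht)
    hBD hη hkey, self_mem_nhdsWithin] with s hs hst hs0
  · have hsτ : s ∈ Icc 0 τ := ⟨hs0, (mem_Iio.1 hst).le.trans ht.2⟩
    rw [zero_mul] at hs
    suffices h : W (e t) - W (e s) ≤ inner ℝ (η s) (z t - D t - (z s - D s)) by linarith
    simp only [W]
    rw [← Finset.sum_sub_distrib, PiLp.inner_apply]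
    refine Finset.sum_le_sum fun i _ => (sq_logErr_tangent (he' t htτ i) (he' s hsτ i)).trans
      (le_of_eq ?_)
    have hne := (hpos i s).ne'
    have hne' := (hpos i t).ne'
    simp only [η, barrierGrad, D, PiLp.sub_apply, RCLike.inner_apply, conj_trivial]
    have h1 : z t i = e t i * gam i t := by simp only [e]; field_simp
    have h2 : z s i = e s i * gam i s := by simp only [e]; field_simp
    rw [h1, h2]
    field_simp
    ring

/-! ### The closed loop in error coordinates -/

section ClosedLoop

variable {N n : ℕ}

theorem ControlParams.funnel_pos (C : ControlParams N n) (k : Fin N) (i : Fin n) (t : ℝ) :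
    0 < C.funnel k i t := by
  have h1 := C.q_pos k i
  have h2 := sub_pos.2 (C.q_lt_p k i)
  unfold PrTRAS.ControlParams.funnel
  positivity

theorem ControlParams.locallyLipschitz_funnel (C : ControlParams N n) (k : Fin N) (i : Fin n) :
    LocallyLipschitz (C.funnel k i) := by
  refine ContDiff.locallyLipschitz (𝕂 := ℝ) ?_
  unfold PrTRAS.ControlParams.funnel
  fun_prop

/-- The signal that block `k` has to track: the tube centre for the first block, the reference
produced by the preceding block for the others. For `k = N` it is the control input. -/
noncomputable def prevRef (C : ControlParams N n) (c : ℝ → E n) (r : ℝ → ℝ) (x : Fin N → E n)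
    (t : ℝ) : (k : ℕ) → k ≤ N → E n
  | 0, _ => c t
  | k + 1, hk => C.ref c r x t k hk

/-- The tracking error of block `k`. -/
noncomputable def trackErr (C : ControlParams N n) (c : ℝ → E n) (r : ℝ → ℝ) (x : Fin N → E n)
    (t : ℝ) (k : ℕ) (hk : k < N) : E n :=
  x ⟨k, hk⟩ - prevRef C c r x t k hk.le

/-- The reference signal of block `k` as a function of time and of its tracking error. -/
noncomputable def stageCtrl (C : ControlParams N n) (r : ℝ → ℝ) :
    (k : ℕ) → k < N → ℝ → E n → E n
  | 0, hk => fun t z => firstControl (C.kappa ⟨0, hk⟩) 0 (r t) z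
  | k + 1, hk => fun t z =>
      stageControl (C.kappa ⟨k + 1, hk⟩) (fun i => C.funnel ⟨k + 1, hk⟩ i t) z

/-- The times and tracking errors of block `k` that lie inside the tube or the funnels. -/
def stageDom (C : ControlParams N n) (r : ℝ → ℝ) : (k : ℕ) → k < N → Set (ℝ × E n)
  | 0, _ => {p | ‖p.2‖ < r p.1}
  | k + 1, hk => {p | ∀ i, |p.2 i| < C.funnel ⟨k + 1, hk⟩ i p.1}

/-- All tracking errors lie inside the tube or the funnels. -/
def InDom (C : ControlParams N n) (c : ℝ → E n) (r : ℝ → ℝ) (p : ℝ × (Fin N → E n)) : Prop :=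
  ∀ k (hk : k < N), (p.1, trackErr C c r p.2 p.1 k hk) ∈ stageDom C r k hk

/-- Given the time, a reference depends on the state only through its own block's error. This lets
the norm-based first stage and the componentwise later stages share one induction. -/
theorem ref_eq_stageCtrl (C : ControlParams N n) (c : ℝ → E n) (r : ℝ → ℝ) (x : Fin N → E n)
    (t : ℝ) (k : ℕ) (hk : k < N) :
    C.ref c r x t k hk = stageCtrl C r k hk t (trackErr C c r x t k hk) := by
  cases k with
  | zero => simp [PrTRAS.ControlParams.ref, stageCtrl, trackErr, prevRef, firstControl]
  | succ k => rfl

theorem input_eq_prevRef (C : ControlParams N n) (hN : 0 < N) (c : ℝ → E n) (r : ℝ → ℝ)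
    (x : Fin N → E n) (t : ℝ) : C.input hN c r x t = prevRef C c r x t N le_rfl := by
  cases N with
  | zero => exact absurd hN (lt_irrefl _)
  | succ m => rfl

variable {C : ControlParams N n} {c : ℝ → E n} {r : ℝ → ℝ}

theorem isOpen_stageDom (hr : Continuous r) (k : ℕ) (hk : k < N) : IsOpen (stageDom C r k hk) := by
  cases k with
  | zero => exact isOpen_lt continuous_snd.norm (hr.comp continuous_fst)
  | succ k =>
    change IsOpen {p : ℝ × E n | ∀ i, |p.2 i| < C.funnel ⟨k + 1, hk⟩ i p.1}
    rw [ofPred_forall]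
    exact isOpen_iInter_of_finite fun i => isOpen_lt
      ((EuclideanSpace.proj i : E n →L[ℝ] ℝ).continuous.comp continuous_snd).abs
      ((ControlParams.locallyLipschitz_funnel C _ i).continuous.comp continuous_fst)

theorem stageBarrier_stage (hr : LocallyLipschitz r) (hpos : ∀ t, 0 < r t) (k : ℕ) (hk : k < N)
    (T : ℝ) : StageBarrier (stageCtrl C r k hk) (stageDom C r k hk) T := by
  cases k with
  | zero => exact stageBarrier_first hr hpos (C.kappa_pos _) T
  | succ k =>
    exact stageBarrier_later (ControlParams.locallyLipschitz_funnel C _)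
      (ControlParams.funnel_pos C _) (C.kappa_pos _) T

/-- Lipschitz regularity is the right notion here: the norm is not differentiable at `0`, and `r` is
merely locally Lipschitz. -/
theorem lipAt_stageCtrl (hr : LocallyLipschitz r) (hpos : ∀ t, 0 < r t) (k : ℕ) (hk : k < N)
    {p : ℝ × E n} (hp : p ∈ stageDom C r k hk) :
    LipAt (fun p : ℝ × E n => stageCtrl C r k hk p.1 p.2) p := by
  cases k with
  | zero =>
    have h0 : ∀ q : ℝ × E n, stageCtrl C r 0 hk q.1 q.2
        = -((C.kappa ⟨0, hk⟩ * logErr (‖q.2‖ / r q.1)) • q.2) := fun q => by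
      simp [stageCtrl, firstControl]
    simp only [h0]
    have hlt : ‖p.2‖ / r p.1 < 1 := (div_lt_one (hpos _)).2 hp
    have hge : 0 ≤ ‖p.2‖ / r p.1 := div_nonneg (norm_nonneg _) (hpos _).le
    have h1 : LipAt (fun q : ℝ × E n => ‖q.2‖ / r q.1) p :=
      LipAt.snd.norm.div (LipAt.comp (hr _) LipAt.fst) (hpos _).ne'
    have h2 := LipAt.comp (f := fun q : ℝ × E n => ‖q.2‖ / r q.1)
      (lipAt_logErr ⟨by linarith, hlt⟩) h1
    exact (((LipAt.const _).mul h2).smul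
      LipAt.snd).neg
  | succ k =>
    simp only [stageCtrl, stageControl_eq]
    refine (LipAt.const _).smul (LipAt.euclidean fun i => ?_)
    have hg : LipAt (fun q : ℝ × E n => C.funnel ⟨k + 1, hk⟩ i q.1) p :=
      LipAt.comp (ControlParams.locallyLipschitz_funnel C _ i _) LipAt.fst
    have hgpos := ControlParams.funnel_pos C ⟨k + 1, hk⟩ i p.1
    have he : LipAt (fun q : ℝ × E n => q.2 i / C.funnel ⟨k + 1, hk⟩ i q.1) p :=
      (LipAt.snd.euclidean_apply i).div hg hgpos.ne'
    have hmem : p.2 i / C.funnel ⟨k + 1, hk⟩ i p.1 ∈ Ioo (-1 : ℝ) 1 := by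
      rw [mem_Ioo, ← abs_lt, abs_div, abs_of_pos hgpos, div_lt_one hgpos]
      exact hp i
    have hne : 1 - (p.2 i / C.funnel ⟨k + 1, hk⟩ i p.1) ^ 2 ≠ 0 := by
      nlinarith [hmem.1, hmem.2]
    refine LipAt.div (LipAt.mul (LipAt.comp (lipAt_logErr hmem) he)
      (LipAt.div (LipAt.const _) ?_ hne)) hg hgpos.ne'
    simp only [pow_two]
    exact (LipAt.const _).sub (he.mul he)

theorem lipAt_prevRef (hc : LocallyLipschitz c) (hr : LocallyLipschitz r) (hpos : ∀ t, 0 < r t)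
    {p : ℝ × (Fin N → E n)} (hp : InDom C c r p) (k : ℕ) (hk : k ≤ N) :
    LipAt (fun q : ℝ × (Fin N → E n) => prevRef C c r q.2 q.1 k hk) p := by
  induction k with
  | zero => exact LipAt.comp (hc _) LipAt.fst
  | succ k ih =>
    have h1 := ih (Nat.le_of_succ_le hk)
    have h2 : LipAt (fun q : ℝ × (Fin N → E n) => trackErr C c r q.2 q.1 k hk) p :=
      (LipAt.comp (f := fun q : ℝ × (Fin N → E n) => q.2) (g := fun x : Fin N → E n => x ⟨k, hk⟩)
        (LipAt.of_lipschitzWith (LipschitzWith.eval _)) LipAt.snd).sub h1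
    have h3 := LipAt.comp (f := fun q : ℝ × (Fin N → E n) =>
      (q.1, trackErr C c r q.2 q.1 k hk)) (lipAt_stageCtrl hr hpos k hk (hp k hk))
      (LipAt.fst.prodMk h2)
    refine h3.congr (Eventually.of_forall fun q => ?_)
    exact ref_eq_stageCtrl C c r q.2 q.1 k hk

theorem lipAt_block (k : Fin N) (p : ℝ × (Fin N → E n)) :
    LipAt (fun q : ℝ × (Fin N → E n) => q.2 k) p :=
  LipAt.comp (f := fun q : ℝ × (Fin N → E n) => q.2) (g := fun x : Fin N → E n => x k)
    (LipAt.of_lipschitzWith (LipschitzWith.eval _)) LipAt.snd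

theorem lipAt_trackErr (hc : LocallyLipschitz c) (hr : LocallyLipschitz r) (hpos : ∀ t, 0 < r t)
    {p : ℝ × (Fin N → E n)} (hp : InDom C c r p) (k : ℕ) (hk : k < N) :
    LipAt (fun q : ℝ × (Fin N → E n) => trackErr C c r q.2 q.1 k hk) p :=
  (lipAt_block _ p).sub (lipAt_prevRef hc hr hpos hp k hk.le)

theorem lipAt_toEuclideanLin {α : Type*} [PseudoMetricSpace α] {p : α}
    {A : α → Matrix (Fin n) (Fin n) ℝ} {v : α → E n} (hA : ∀ a b, LipAt (fun q => A q a b) p)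
    (hv : LipAt v p) : LipAt (fun q => Matrix.toEuclideanLin (A q) (v q)) p := by
  simp only [Matrix.toLpLin_apply]
  refine LipAt.euclidean fun a => ?_
  simp only [Matrix.mulVec, dotProduct]
  exact LipAt.sum fun b _ => (hA a b).mul (hv.euclidean_apply b)

/-- The closed-loop vector field without disturbances. -/
noncomputable def closedField (sys : PureFeedbackSystem N n) (C : ControlParams N n) (hN : 0 < N)
    (c : ℝ → E n) (r : ℝ → ℝ) (p : ℝ × (Fin N → E n)) (i : Fin N) : E n :=
  sys.velocity p.2 (C.input hN c r p.2 p.1) 0 i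

theorem velocity_eq_closedField (sys : PureFeedbackSystem N n) (hN : 0 < N) (x : Fin N → E n)
    (t : ℝ) (d : E n) (i : Fin N) :
    sys.velocity x (C.input hN c r x t) d i = closedField sys C hN c r (t, x) i + d := by
  simp [closedField, PrTRAS.PureFeedbackSystem.velocity]

variable {sys : PureFeedbackSystem N n}

theorem lipAt_closedField (hlip : sys.LocLipschitz) (hN : 0 < N) (hc : LocallyLipschitz c)
    (hr : LocallyLipschitz r) (hpos : ∀ t, 0 < r t) {p : ℝ × (Fin N → E n)}
    (hp : InDom C c r p) : LipAt (closedField sys C hN c r) p := by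
  refine LipAt.pi fun i => ?_
  have hres : LipAt (fun q : ℝ × (Fin N → E n) => fun j : {j : Fin N // j ≤ i} => q.2 j.1) p :=
    LipAt.pi fun j => lipAt_block _ p
  refine LipAt.add (LipAt.add (LipAt.comp ((hlip i).1 _) hres) (lipAt_toEuclideanLin
    (fun a b => LipAt.comp ((hlip i).2 a b _) hres) ?_)) (LipAt.const _)
  unfold drive
  split_ifs with h
  · exact lipAt_block _ p
  · simp only [input_eq_prevRef]
    exact lipAt_prevRef hc hr hpos hp N le_rfl

/-- A trajectory of the closed loop on `[0, τ]` along which all tracking errors stay inside the tube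
and the funnels. -/
structure Admissible (sys : PureFeedbackSystem N n) (C : ControlParams N n) (hN : 0 < N)
    (c : ℝ → E n) (r : ℝ → ℝ) (w : Fin N → ℝ → E n) (x₀ : Fin N → E n) (τ : ℝ)
    (x : ℝ → Fin N → E n) : Prop where
  cont : ContinuousOn x (Icc 0 τ)
  init : x 0 = x₀
  dom : ∀ t ∈ Icc 0 τ, InDom C c r (t, x t)
  incr : ∀ i, ∀ s ∈ Icc 0 τ, ∀ t ∈ Icc 0 τ,
    x t i - x s i = ∫ σ in s..t, (closedField sys C hN c r (σ, x σ) i + w i σ)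

/-- The domain alone bounds the errors, by the tube radius or the funnel widths, before anything is
known about the dynamics. -/
theorem exists_bound_stageDom (hr : Continuous r) (T : ℝ) (k : ℕ) (hk : k < N) :
    ∃ B : ℝ, 0 ≤ B ∧ ∀ p ∈ stageDom C r k hk, p.1 ∈ Icc 0 T → ‖p.2‖ ≤ B := by
  cases k with
  | zero =>
    obtain ⟨B, hB⟩ := (isCompact_Icc (a := (0 : ℝ)) (b := T)).exists_bound_of_continuousOn
      hr.continuousOn
    refine ⟨|B|, abs_nonneg _, fun p hp ht => ?_⟩
    exact (le_of_lt hp).trans ((le_abs_self _).trans ((hB _ ht).trans (le_abs_self _)))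
  | succ k =>
    choose B hB using fun i => (isCompact_Icc (a := (0 : ℝ)) (b := T)).exists_bound_of_continuousOn
      (ControlParams.locallyLipschitz_funnel C ⟨k + 1, hk⟩ i).continuous.continuousOn
    refine ⟨∑ i, |B i|, by positivity, fun p hp ht => (norm_le_sum_abs _).trans
      (Finset.sum_le_sum fun i _ => (hp i).le.trans ?_)⟩
    exact (le_abs_self _).trans ((hB i _ ht).trans (le_abs_self _))

theorem exists_bound_block (hlip : sys.LocLipschitz) (i : Fin N) (R : ℝ) :
    ∃ M : ℝ, 0 ≤ M ∧ ∀ z : {j : Fin N // j ≤ i} → E n, ‖z‖ ≤ R →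
      ‖sys.f i z‖ ≤ M ∧ ∀ v, ‖Matrix.toEuclideanLin (sys.g i z) v‖ ≤ M * ‖v‖ := by
  have hK := isCompact_closedBall (0 : {j : Fin N // j ≤ i} → E n) R
  obtain ⟨Mf, hMf⟩ := hK.exists_bound_of_continuousOn (hlip i).1.continuous.continuousOn
  have hg : Continuous fun z => Matrix.toEuclideanCLM (𝕜 := ℝ) (sys.g i z) := by
    have h1 : Continuous (sys.g i) :=
      continuous_pi fun a => continuous_pi fun b => ((hlip i).2 a b).continuous
    exact (LinearMap.continuous_of_finiteDimensional
      (Matrix.toEuclideanCLM (𝕜 := ℝ) (n := Fin n)).toAlgEquiv.toLinearMap).comp h1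
  obtain ⟨Mg, hMg⟩ := hK.exists_bound_of_continuousOn hg.continuousOn
  refine ⟨|Mf| + |Mg|, by positivity, fun z hz => ⟨?_, fun v => ?_⟩⟩
  · have := hMf z (by simpa using hz)
    linarith [le_abs_self Mf, abs_nonneg Mg]
  · refine ((Matrix.toEuclideanCLM (𝕜 := ℝ) (sys.g i z)).le_opNorm v).trans ?_
    have := hMg z (by simpa using hz)
    gcongr
    linarith [le_abs_self Mg, abs_nonneg Mf]

end ClosedLoop

/-! ### A priori bounds along the cascade. -/

section Apriori

variable {N n : ℕ} {C : ControlParams N n} {c : ℝ → E n} {r : ℝ → ℝ}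
  {sys : PureFeedbackSystem N n} {hN : 0 < N} {w : Fin N → ℝ → E n} {x₀ : Fin N → E n}

theorem intervalIntegrable_of_measurable_of_bounded {F : Type*} [NormedAddCommGroup F]
    [MeasurableSpace F] [BorelSpace F] [SecondCountableTopology F] {f : ℝ → F} {K : ℝ}
    (hf : Measurable f) (hK : ∀ t, ‖f t‖ ≤ K) (a b : ℝ) : IntervalIntegrable f volume a b := by
  refine (intervalIntegrable_const (c := K)).mono_fun hf.aestronglyMeasurable ?_
  exact Eventually.of_forall fun t => (hK t).trans (le_abs_self K)

/-- The mismatch is the tracking error of the next block, and zero for the last block. It decouples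
a stage from the later ones, which act on it as a bounded perturbation. -/
theorem exists_bound_drive_sub_ref (hr : Continuous r) (T : ℝ) (k : ℕ) (hk : k < N) :
    ∃ B : ℝ, 0 ≤ B ∧ ∀ p : ℝ × (Fin N → E n), InDom C c r p → p.1 ∈ Icc 0 T →
      ‖drive p.2 (C.input hN c r p.2 p.1) ⟨k, hk⟩ - C.ref c r p.2 p.1 k hk‖ ≤ B := by
  rcases Nat.lt_or_ge (k + 1) N with h | h
  · obtain ⟨B, hB0, hB⟩ := exists_bound_stageDom (C := C) hr T (k + 1) h
    refine ⟨B, hB0, fun p hp ht => ?_⟩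
    simpa [drive, h, trackErr, prevRef] using
      hB (p.1, trackErr C c r p.2 p.1 (k + 1) h) (hp (k + 1) h) ht
  · refine ⟨0, le_rfl, fun p hp ht => ?_⟩
    obtain rfl : N = k + 1 := by omega
    simp [drive, PrTRAS.ControlParams.input]

theorem Admissible.continuousOn_field {τ : ℝ} {x : ℝ → Fin N → E n}
    (hx : Admissible sys C hN c r w x₀ τ x) (hlip : sys.LocLipschitz) (hc : LocallyLipschitz c)
    (hr : LocallyLipschitz r) (hpos : ∀ t, 0 < r t) :
    ContinuousOn (fun t => closedField sys C hN c r (t, x t)) (Icc 0 τ) := fun t ht =>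
  ContinuousAt.comp_continuousWithinAt (f := fun t => (t, x t))
    (lipAt_closedField hlip hN hc hr hpos (hx.dom t ht)).continuousAt
    (continuousWithinAt_id.prodMk (hx.cont t ht))

theorem Admissible.continuousOn_trackErr {τ : ℝ} {x : ℝ → Fin N → E n}
    (hx : Admissible sys C hN c r w x₀ τ x) (hc : LocallyLipschitz c)
    (hr : LocallyLipschitz r) (hpos : ∀ t, 0 < r t) (k : ℕ) (hk : k < N) :
    ContinuousOn (fun t => trackErr C c r (x t) t k hk) (Icc 0 τ) := fun t ht =>
  ContinuousAt.comp_continuousWithinAt (f := fun t => (t, x t))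
    (g := fun p : ℝ × (Fin N → E n) => trackErr C c r p.2 p.1 k hk)
    (lipAt_trackErr hc hr hpos (hx.dom t ht) k hk).continuousAt
    (continuousWithinAt_id.prodMk (hx.cont t ht))

/-- With `φ` the driving term this shows that the rest of the state is Lipschitz, as `StageBarrier`
requires; with `φ = 0` it bounds the speed of the block itself. -/
theorem Admissible.norm_increment_sub_integral_le {τ : ℝ} {x : ℝ → Fin N → E n}
    (hx : Admissible sys C hN c r w x₀ τ x) (hlip : sys.LocLipschitz) (hc : LocallyLipschitz c)
    (hr : LocallyLipschitz r) (hpos : ∀ t, 0 < r t) (hw : ∀ i, Measurable (w i)) {Cw : ℝ}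
    (hwb : ∀ i t, ‖w i t‖ ≤ Cw) (i : Fin N) {φ : ℝ → E n} (hφ : Continuous φ) {M : ℝ}
    (hM : ∀ σ ∈ Icc 0 τ, ‖closedField sys C hN c r (σ, x σ) i + w i σ - φ σ‖ ≤ M) {s t : ℝ}
    (ht : t ∈ Icc 0 τ) (hs : s ∈ Icc 0 t) :
    ‖x t i - x s i - ∫ σ in s..t, φ σ‖ ≤ M * |t - s| := by
  have hsub : uIcc s t ⊆ Icc 0 τ := by
    rw [uIcc_of_le hs.2]; exact Icc_subset_Icc hs.1 ht.2
  have hint : IntervalIntegrable (fun σ => closedField sys C hN c r (σ, x σ) i) volume s t :=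
    (((continuous_apply i).comp_continuousOn
      (hx.continuousOn_field hlip hc hr hpos)).mono hsub).intervalIntegrable
  rw [hx.incr i s ⟨hs.1, hs.2.trans ht.2⟩ t ht, ← intervalIntegral.integral_sub
    (hint.add (intervalIntegrable_of_measurable_of_bounded (hw i) (hwb i) s t))
    (hφ.intervalIntegrable s t)]
  refine intervalIntegral.norm_integral_le_of_norm_le_const fun σ hσ => hM σ (hsub ?_)
  exact uIoc_subset_uIcc hσ

theorem lipAt_drivingTerm (hlip : sys.LocLipschitz) (hc : LocallyLipschitz c)
    (hr : LocallyLipschitz r) (hpos : ∀ t, 0 < r t) {p : ℝ × (Fin N → E n)}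
    (hp : InDom C c r p) (k : ℕ) (hk : k < N) :
    LipAt (fun q : ℝ × (Fin N → E n) => Matrix.toEuclideanLin
      (sys.g ⟨k, hk⟩ fun j => q.2 j.1) (stageCtrl C r k hk q.1 (trackErr C c r q.2 q.1 k hk)))
      p := by
  have h1 : LipAt (fun q : ℝ × (Fin N → E n) => (q.1, trackErr C c r q.2 q.1 k hk)) p :=
    LipAt.fst.prodMk (lipAt_trackErr hc hr hpos hp k hk)
  have h2 : LipAt (fun q : ℝ × (Fin N → E n) =>
      stageCtrl C r k hk q.1 (trackErr C c r q.2 q.1 k hk)) p :=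
    LipAt.comp (f := fun q : ℝ × (Fin N → E n) => (q.1, trackErr C c r q.2 q.1 k hk))
      (g := fun q : ℝ × E n => stageCtrl C r k hk q.1 q.2)
      (lipAt_stageCtrl hr hpos k hk (hp k hk)) h1
  have h3 : LipAt (fun q : ℝ × (Fin N → E n) =>
      fun j : {j : Fin N // j ≤ ⟨k, hk⟩} => q.2 j.1) p :=
    LipAt.pi fun j => lipAt_block _ _
  have h4 : ∀ a b, LipAt (fun q : ℝ × (Fin N → E n) =>
      sys.g ⟨k, hk⟩ (fun j => q.2 j.1) a b) p := fun a b =>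
    LipAt.comp (f := fun q : ℝ × (Fin N → E n) => fun j : {j : Fin N // j ≤ ⟨k, hk⟩} => q.2 j.1)
      (g := fun z => sys.g ⟨k, hk⟩ z a b) ((hlip ⟨k, hk⟩).2 a b _) h3
  exact lipAt_toEuclideanLin (A := fun q : ℝ × (Fin N → E n) =>
    sys.g ⟨k, hk⟩ fun j => q.2 j.1) h4 h2

/-- Along all admissible trajectories on subintervals of `[0, T]`, the tracking errors stay in fixed
compact sets. -/
theorem apriori_stages (hlip : sys.LocLipschitz) (hpd : sys.UniformlyPosDef)
    (hc : LocallyLipschitz c) (hr : LocallyLipschitz r) (hpos : ∀ t, 0 < r t)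
    (hw : ∀ i, Measurable (w i)) {Cw : ℝ} (hCw : 0 ≤ Cw) (hwb : ∀ i t, ‖w i t‖ ≤ Cw)
    (hx₀ : InDom C c r (0, x₀)) (T : ℝ) (m : ℕ) (hm : m ≤ N) :
    ∃ R L : ℝ, 0 ≤ R ∧ 0 ≤ L ∧ ∃ S : (k : ℕ) → k < N → Set (ℝ × E n),
      (∀ k hk, k < m → S k hk ⊆ stageDom C r k hk ∧ IsCompact (S k hk)) ∧
      ∀ τ ∈ Icc 0 T, ∀ x, Admissible sys C hN c r w x₀ τ x →
        (∀ k hk, k < m → ∀ t ∈ Icc 0 τ,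
          (t, trackErr C c r (x t) t k hk) ∈ S k hk ∧ ‖x t ⟨k, hk⟩‖ ≤ R) ∧
        (∀ t ∈ Icc 0 τ, ‖prevRef C c r (x t) t m hm‖ ≤ R) ∧
        ∀ t ∈ Icc 0 τ, ∀ s ∈ Icc 0 t,
          ‖prevRef C c r (x t) t m hm - prevRef C c r (x s) s m hm‖ ≤ L * |t - s| := by
  -- The bound and the Lipschitz constant of the tracked reference are carried along because they
  -- enter the constants of the next stage.
  induction m with
  | zero =>
    obtain ⟨L, hL⟩ := LipAt.exists_lipschitzOnWith_of_compact
      (isCompact_Icc (a := (0 : ℝ)) (b := T)) fun t _ => hc t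
    obtain ⟨R, hR⟩ := (isCompact_Icc (a := (0 : ℝ)) (b := T)).exists_bound_of_continuousOn
      hc.continuous.continuousOn
    refine ⟨|R|, L, abs_nonneg _, L.2, fun _ _ => ∅, fun k hk h => absurd h (Nat.not_lt_zero k),
      fun τ hτ x hx => ⟨fun k hk h => absurd h (Nat.not_lt_zero k), fun t ht => ?_,
        fun t ht s hs => ?_⟩⟩
    · exact (hR t ⟨ht.1, ht.2.trans hτ.2⟩).trans (le_abs_self _)
    · have := hL.dist_le_mul t ⟨ht.1, ht.2.trans hτ.2⟩ s ⟨hs.1, hs.2.trans (ht.2.trans hτ.2)⟩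
      rwa [dist_eq_norm, Real.dist_eq] at this
  | succ m ih =>
    have hk : m < N := hm
    obtain ⟨R, L, hR0, hL0, S, hS, hbound⟩ := ih hk.le
    obtain ⟨B, hB0, hB⟩ := exists_bound_stageDom (C := C) hr.continuous T m hk
    obtain ⟨B', hB'0, hB'⟩ := exists_bound_drive_sub_ref (C := C) (c := c) (hN := hN)
      hr.continuous T m hk
    -- Block `m` is reference plus error, hence bounded by `R + B`; the earlier blocks are bounded
    -- by `R`.
    obtain ⟨Mb, hMb0, hMb⟩ := exists_bound_block hlip ⟨m, hk⟩ (R + B)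
    obtain ⟨glow, hglow, hpd'⟩ := hpd ⟨m, hk⟩
    -- The perturbation rate adds up the drift, the input mismatch, the disturbance and the motion
    -- of the reference.
    obtain ⟨Sm, hSm, hSmc, hbar⟩ := stageBarrier_stage (C := C) hr hpos m hk T
      (Mb + Mb * B' + Cw + L) glow (by positivity) hglow (trackErr C c r x₀ 0 m hk) (hx₀ m hk)
    obtain ⟨Λ, hΛ⟩ := LipAt.exists_lipschitzOnWith_of_compact hSmc
      fun p hp => lipAt_stageCtrl hr hpos m hk (hSm hp)
    obtain ⟨Rc, hRc⟩ := hSmc.exists_bound_of_continuousOn hΛ.continuousOn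
    set V : ℝ := Mb + Mb * (B' + |Rc|) + Cw
    have hV0 : 0 ≤ V := by positivity
    -- The new reference is `stageCtrl` evaluated at time and error. These move at rates at most `1`
    -- and `V + L`, and `Λ` is its Lipschitz constant on `Sm`.
    refine ⟨R + B + |Rc|, Λ * (1 + (V + L)), by positivity, by positivity,
      fun k hk' => if k = m then Sm else S k hk', fun k hk' h => ?_, fun τ hτ x hx => ?_⟩
    · rcases eq_or_ne k m with rfl | hne
      · simpa using ⟨hSm, hSmc⟩
      · simpa [hne] using hS k hk' (by omega)
    obtain ⟨hx1, hx2, hx3⟩ := hbound τ hτ x hx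
    have hT : ∀ t ∈ Icc 0 τ, t ∈ Icc 0 T := fun t ht => ⟨ht.1, ht.2.trans hτ.2⟩
    have hxm : ∀ t ∈ Icc 0 τ, ‖x t ⟨m, hk⟩‖ ≤ R + B := fun t ht => by
      have h1 : x t ⟨m, hk⟩ = prevRef C c r (x t) t m hk.le + trackErr C c r (x t) t m hk := by
        simp [trackErr]
      rw [h1]
      exact (norm_add_le _ _).trans
        (add_le_add (hx2 t ht) (hB (t, trackErr C c r (x t) t m hk) (hx.dom t ht m hk) (hT t ht)))
    have hvec : ∀ t ∈ Icc 0 τ, ‖fun j : {j : Fin N // j ≤ ⟨m, hk⟩} => x t j.1‖ ≤ R + B := by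
      refine fun t ht => (pi_norm_le_iff_of_nonneg (by positivity)).2 fun j => ?_
      rcases (Fin.le_def.1 j.2).eq_or_lt with h | h
      · have : j.1 = ⟨m, hk⟩ := Fin.ext h
        rw [this]; exact hxm t ht
      · exact ((hx1 j.1 j.1.2 h t ht).2).trans (by linarith)
    -- the dominant part of the velocity
    set φ : ℝ → E n := fun t => Matrix.toEuclideanLin (sys.g ⟨m, hk⟩ fun j => x t j.1)
      (stageCtrl C r m hk t (trackErr C c r (x t) t m hk))
    have hφc : ContinuousOn φ (Icc 0 τ) := by
      intro t ht
      have h1 := lipAt_drivingTerm (C := C) hlip hc hr hpos (hx.dom t ht) m hk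
      exact ContinuousAt.comp_continuousWithinAt (f := fun t => (t, x t)) h1.continuousAt
        (continuousWithinAt_id.prodMk (hx.cont t ht))
    -- Extending the driving term by constants makes its primitive differentiable from both sides,
    -- also at the endpoint `τ`.
    have hφ' : Continuous (IccExtend hτ.1 ((Icc 0 τ).domRestrict φ)) :=
      (continuousOn_iff_continuous_domRestrict.1 hφc).Icc_extend'
    set φ' : ℝ → E n := IccExtend hτ.1 ((Icc 0 τ).domRestrict φ)
    have hφeq : ∀ t ∈ Icc 0 τ, φ' t = φ t := fun t ht => IccExtend_of_mem hτ.1 _ ht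
    have hrest : ∀ σ ∈ Icc 0 τ,
        ‖closedField sys C hN c r (σ, x σ) ⟨m, hk⟩ + w ⟨m, hk⟩ σ - φ' σ‖ ≤ Mb + Mb * B' + Cw := by
      intro σ hσ
      have h1 := hMb _ (hvec σ hσ)
      have h2 : closedField sys C hN c r (σ, x σ) ⟨m, hk⟩ + w ⟨m, hk⟩ σ - φ' σ
          = sys.f ⟨m, hk⟩ (fun j => x σ j.1) + Matrix.toEuclideanLin
              (sys.g ⟨m, hk⟩ fun j => x σ j.1) (drive (x σ) (C.input hN c r (x σ) σ) ⟨m, hk⟩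
                - C.ref c r (x σ) σ m hk) + w ⟨m, hk⟩ σ := by
        rw [hφeq σ hσ, map_sub, ref_eq_stageCtrl]
        simp only [closedField, PrTRAS.PureFeedbackSystem.velocity, φ]
        abel
      rw [h2]
      refine (norm_add₃_le).trans (add_le_add (add_le_add h1.1 ((h1.2 _).trans ?_)) (hwb _ _))
      gcongr
      exact hB' (σ, x σ) (hx.dom σ hσ) (hT σ hσ)
    have hinS : ∀ t ∈ Icc 0 τ, (t, trackErr C c r (x t) t m hk) ∈ Sm := by
      -- Here `A` is the primitive of the driving term and `B` is everything else.
      refine hbar τ hτ (fun t => trackErr C c r (x t) t m hk) (fun t => ∫ σ in (0 : ℝ)..t, φ' σ)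
        (fun t => trackErr C c r (x t) t m hk - ∫ σ in (0 : ℝ)..t, φ' σ)
        (fun t => Matrix.toEuclideanLin (sys.g ⟨m, hk⟩ fun j => x t j.1)) (fun t _ => by simp)
        (hx.continuousOn_trackErr hc hr hpos m hk) (by simp only [hx.init])
        (fun t ht => hx.dom t ht m hk) (fun t _ y => le_inner_toEuclideanLin (hpd' _) y)
        (fun t ht => ?_) fun t ht s hs => ?_
      · have h1 := intervalIntegral.integral_hasDerivAt_right (hφ'.intervalIntegrable 0 t)
          (hφ'.stronglyMeasurableAtFilter _ _) hφ'.continuousAt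
        rwa [hφeq t ⟨ht.1.le, ht.2⟩] at h1
      · have h1 := hx.norm_increment_sub_integral_le hlip hc hr hpos hw hwb ⟨m, hk⟩ hφ' hrest ht hs
        have h2 := hx3 t ht s hs
        rw [← intervalIntegral.integral_interval_sub_left (hφ'.intervalIntegrable 0 t)
          (hφ'.intervalIntegrable 0 s)] at h1
        calc _ = ‖(x t ⟨m, hk⟩ - x s ⟨m, hk⟩ - ((∫ σ in (0 : ℝ)..t, φ' σ) -
                ∫ σ in (0 : ℝ)..s, φ' σ)) - (prevRef C c r (x t) t m hk.le
                - prevRef C c r (x s) s m hk.le)‖ := by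
              simp only [trackErr]; congr 1; abel
          _ ≤ _ := norm_sub_le _ _
          _ ≤ (Mb + Mb * B' + Cw + L) * |t - s| := by linarith
    have href : ∀ t, prevRef C c r (x t) t (m + 1) hm
        = stageCtrl C r m hk t (trackErr C c r (x t) t m hk) := fun t =>
      ref_eq_stageCtrl C c r (x t) t m hk
    have hrefb : ∀ t ∈ Icc 0 τ,
        ‖stageCtrl C r m hk t (trackErr C c r (x t) t m hk)‖ ≤ |Rc| := fun t ht =>
      (hRc _ (hinS t ht)).trans (le_abs_self _)
    refine ⟨fun k hk' h t ht => ?_, fun t ht => ?_, fun t ht s hs => ?_⟩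
    · rcases eq_or_ne k m with rfl | hne
      · simp only [if_true]
        exact ⟨hinS t ht, (hxm t ht).trans (by linarith [abs_nonneg Rc])⟩
      · simp only [hne, if_false]
        have h1 := hx1 k hk' (by omega) t ht
        exact ⟨h1.1, h1.2.trans (by linarith [abs_nonneg Rc])⟩
    · rw [href]
      exact (hrefb t ht).trans (by linarith)
    · have hsτ : s ∈ Icc 0 τ := ⟨hs.1, hs.2.trans ht.2⟩
      rw [href, href]
      have h1 := hΛ.dist_le_mul _ (hinS t ht) _ (hinS s hsτ)
      rw [dist_eq_norm] at h1
      refine h1.trans ?_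
      rw [mul_assoc]
      gcongr
      rw [Prod.dist_eq, Real.dist_eq]
      refine max_le (by nlinarith [abs_nonneg (t - s)]) ?_
      rw [dist_eq_norm]
      have h2 := hx.norm_increment_sub_integral_le hlip hc hr hpos hw hwb ⟨m, hk⟩
        (φ := fun _ => 0) continuous_const (M := V) (fun σ hσ => ?_) ht hs
      · have h3 := hx3 t ht s hs
        simp only [intervalIntegral.integral_zero, sub_zero] at h2
        calc _ = ‖(x t ⟨m, hk⟩ - x s ⟨m, hk⟩) - (prevRef C c r (x t) t m hk.le
                - prevRef C c r (x s) s m hk.le)‖ := by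
              simp only [trackErr]; congr 1; abel
          _ ≤ _ := norm_sub_le _ _
          _ ≤ _ := by nlinarith [abs_nonneg (t - s)]
      · have h3 := hrest σ hσ
        have h4 : ‖φ' σ‖ ≤ Mb * |Rc| := by
          rw [hφeq σ hσ]
          exact ((hMb _ (hvec σ hσ)).2 _).trans (by gcongr; exact hrefb σ hσ)
        rw [sub_zero]
        calc _ = ‖(closedField sys C hN c r (σ, x σ) ⟨m, hk⟩ + w ⟨m, hk⟩ σ - φ' σ) + φ' σ‖ := by
              rw [sub_add_cancel]
          _ ≤ _ := norm_add_le _ _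
          _ ≤ V := by simp only [V]; linarith

end Apriori

/-- A vector field that is locally Lipschitz at the points of a compact set `K` agrees on `K` with a
continuous one that has an integral curve on all of `[0, T]` from any initial value. -/
theorem exists_integralCurve_of_lipAt_compact {F : Type*} [NormedAddCommGroup F] [NormedSpace ℝ F]
    [FiniteDimensional ℝ F] {K : Set (ℝ × F)} (hK : IsCompact K) {G : ℝ × F → F}
    (hG : ∀ p ∈ K, LipAt G p) (y₀ : F) {T : ℝ} (hT : 0 ≤ T) :
    ∃ (H : ℝ × F → F) (α : ℝ → F), Continuous H ∧ EqOn H G K ∧ α 0 = y₀ ∧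
      ∀ t ∈ Icc 0 T, HasDerivWithinAt α (H (t, α t)) (Icc 0 T) t := by
  have : CompleteSpace F := FiniteDimensional.complete ℝ F
  have : ProperSpace F := FiniteDimensional.proper ℝ F
  obtain ⟨L, hL⟩ := LipAt.exists_lipschitzOnWith_of_compact hK hG
  obtain ⟨g, hg, hgG⟩ := hL.extend_finite_dimension
  obtain ⟨R, hR⟩ := hK.exists_bound_of_continuousOn (f := fun p : ℝ × F => p.2)
    continuous_snd.continuousOn
  -- The cut-off is `1` on `K` and vanishes for `‖p.2‖ ≥ R + 1`, so `H` is bounded on `[0, T]` and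
  -- one Picard–Lindelöf step covers the whole interval.
  set χ : ℝ × F → ℝ := fun p => max 0 (min 1 (R + 1 - ‖p.2‖))
  have hχ : ∀ p, LipAt χ p := fun p =>
    LipAt.comp (f := fun p : ℝ × F => R + 1 - ‖p.2‖) (g := fun u : ℝ => max 0 (min 1 u))
      (LipAt.of_lipschitzWith ((LipschitzWith.id.const_min 1).const_max 0))
      ((LipAt.const _).sub LipAt.snd.norm)
  set H : ℝ × F → F := fun p => χ p • g p
  have hH : ∀ p, LipAt H p := fun p => (hχ p).smul (LipAt.of_lipschitzWith hg)
  have hHc : Continuous H := continuous_iff_continuousAt.2 fun p => (hH p).continuousAt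
  obtain ⟨M, hM⟩ := ((isCompact_Icc (a := (0 : ℝ)) (b := T)).prod
    (isCompact_closedBall (0 : F) (R + 1))).exists_bound_of_continuousOn hg.continuous.continuousOn
  have hχ1 : ∀ p, |χ p| ≤ 1 := fun p => by
    rw [abs_of_nonneg (le_max_left _ _)]
    exact max_le zero_le_one (min_le_left _ _)
  have hbd : ∀ t ∈ Icc 0 T, ∀ y, ‖H (t, y)‖ ≤ (|M|).toNNReal := by
    intro t ht y
    rw [Real.coe_toNNReal _ (abs_nonneg _)]
    simp only [H]
    rw [norm_smul, Real.norm_eq_abs]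
    rcases le_or_gt ‖y‖ (R + 1) with h | h
    · have h1 := hM (t, y) ⟨ht, by simpa using h⟩
      calc _ ≤ 1 * |M| := mul_le_mul (hχ1 _) (h1.trans (le_abs_self _)) (norm_nonneg _) zero_le_one
        _ = _ := one_mul _
    · have h1 : χ (t, y) = 0 :=
        max_eq_left ((min_le_right _ _).trans (by simp only; linarith))
      rw [h1]; simp
  -- A curve of speed at most `|M|` travels no farther than this during `[0, T]`.
  set a : ℝ≥0 := (|M|).toNNReal * T.toNNReal
  obtain ⟨Λ, hΛ⟩ := LipAt.exists_lipschitzOnWith_of_compact ((isCompact_Icc (a := (0 : ℝ))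
    (b := T)).prod (isCompact_closedBall y₀ (a : ℝ))) fun p _ => hH p
  have hPL : IsPicardLindelof (fun t y => H (t, y)) (⟨0, le_rfl, hT⟩ : Icc 0 T) y₀ a 0
      (|M|).toNNReal Λ := by
    refine ⟨fun t ht y hy y' hy' => ?_, fun y hy => ?_, fun t ht y hy => hbd t ht y, ?_⟩
    · have := hΛ (x := (t, y)) ⟨ht, hy⟩ (y := (t, y')) ⟨ht, hy'⟩
      simpa [Prod.edist_eq] using this
    · exact (hHc.comp (continuous_id.prodMk continuous_const)).continuousOn
    · simp [a, hT]
  obtain ⟨α, hα0, hα⟩ := hPL.exists_eq_forall_mem_Icc_hasDerivWithinAt₀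
  refine ⟨H, α, hHc, fun p hp => ?_, hα0, hα⟩
  have h1 : χ p = 1 := by
    have := hR p hp
    simp only [χ]
    rw [min_eq_left (by linarith), max_eq_right zero_le_one]
  simp only [H]
  rw [h1, one_smul, hgG hp]

/-! ### Existence by continuation, and uniqueness. -/

section Existence

variable {N n : ℕ} {C : ControlParams N n} {c : ℝ → E n} {r : ℝ → ℝ}
  {sys : PureFeedbackSystem N n} {hN : 0 < N} {w : Fin N → ℝ → E n} {x₀ : Fin N → E n}

/-- The signals tracked by the blocks, as functions of the tracking errors. -/
noncomputable def prevOfErr (C : ControlParams N n) (c : ℝ → E n) (r : ℝ → ℝ) (t : ℝ)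
    (z : Fin N → E n) : (k : ℕ) → k < N → E n
  | 0, _ => c t
  | k + 1, hk => stageCtrl C r k (Nat.lt_of_succ_lt hk) t (z ⟨k, Nat.lt_of_succ_lt hk⟩)

/-- The state with given tracking errors. -/
noncomputable def stateOfErr (C : ControlParams N n) (c : ℝ → E n) (r : ℝ → ℝ) (t : ℝ)
    (z : Fin N → E n) : Fin N → E n := fun k => prevOfErr C c r t z k.1 k.2 + z k

theorem prevRef_eq_prevOfErr (x : Fin N → E n) (t : ℝ) (k : ℕ) (hk : k < N) :
    prevRef C c r x t k hk.le
      = prevOfErr C c r t (fun j => trackErr C c r x t j.1 j.2) k hk := by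
  cases k with
  | zero => rfl
  | succ k => exact ref_eq_stageCtrl C c r x t k _

theorem stateOfErr_trackErr (x : Fin N → E n) (t : ℝ) :
    stateOfErr C c r t (fun j => trackErr C c r x t j.1 j.2) = x := by
  funext k
  rw [stateOfErr, ← prevRef_eq_prevOfErr]
  simp [trackErr]

/-- Passing to tracking errors is a triangular change of variables; together with
`stateOfErr_trackErr` this makes it a bijection at each time. -/
theorem trackErr_stateOfErr (t : ℝ) (z : Fin N → E n) (k : ℕ) (hk : k < N) :
    trackErr C c r (stateOfErr C c r t z) t k hk = z ⟨k, hk⟩ := by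
  induction k with
  | zero => simp [trackErr, stateOfErr, prevRef, prevOfErr]
  | succ k ih =>
    have h1 : prevRef C c r (stateOfErr C c r t z) t (k + 1) hk.le
        = prevOfErr C c r t z (k + 1) hk := by
      have := ref_eq_stageCtrl C c r (stateOfErr C c r t z) t k (Nat.lt_of_succ_lt hk)
      rw [ih] at this
      exact this
    rw [trackErr, h1]
    simp [stateOfErr]

/-- The set is the image of a compact set of errors under the inverse change of variables, which is
continuous there. A preimage argument is not available, since `trackErr` need not be continuous
outside the domain. -/
theorem isCompact_image_stateOfErr (hc : LocallyLipschitz c) (hr : LocallyLipschitz r)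
    (hpos : ∀ t, 0 < r t) (hN : 0 < N) {S : (k : ℕ) → k < N → Set (ℝ × E n)}
    (hS : ∀ k hk, S k hk ⊆ stageDom C r k hk) (hSc : ∀ k hk, IsCompact (S k hk)) :
    IsCompact {p : ℝ × (Fin N → E n) |
      ∀ k hk, (p.1, trackErr C c r p.2 p.1 k hk) ∈ S k hk} := by
  set Z : Set (ℝ × (Fin N → E n)) := {p | ∀ k hk, (p.1, p.2 ⟨k, hk⟩) ∈ S k hk}
  have hZ : IsCompact Z := by
    refine (((hSc 0 hN).image continuous_fst).prod (isCompact_univ_pi fun k : Fin N =>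
      (hSc k.1 k.2).image continuous_snd)).of_isClosed_subset ?_ fun p hp =>
        ⟨⟨_, hp 0 hN, rfl⟩, fun k _ => ⟨_, hp k.1 k.2, rfl⟩⟩
    simp only [Z, ofPred_forall]
    exact isClosed_iInter fun k => isClosed_iInter fun hk => (hSc k hk).isClosed.preimage
      (continuous_fst.prodMk ((continuous_apply (⟨k, hk⟩ : Fin N)).comp continuous_snd))
  have hcont : ContinuousOn (fun p : ℝ × (Fin N → E n) => (p.1, stateOfErr C c r p.1 p.2)) Z := by
    intro p hp
    refine ContinuousAt.continuousWithinAt (continuousAt_fst.prodMk (continuousAt_pi.2 fun k => ?_))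
    refine ContinuousAt.add ?_ ((continuous_apply k).continuousAt.comp continuousAt_snd)
    obtain ⟨k, hk⟩ := k
    cases k with
    | zero => exact hc.continuous.continuousAt.comp continuousAt_fst
    | succ k =>
      have hk' := Nat.lt_of_succ_lt hk
      exact ContinuousAt.comp (f := fun p : ℝ × (Fin N → E n) => (p.1, p.2 ⟨k, hk'⟩))
        (g := fun q : ℝ × E n => stageCtrl C r k hk' q.1 q.2)
        (lipAt_stageCtrl hr hpos k hk' (hS k hk' (hp k hk'))).continuousAt
        (continuousAt_fst.prodMk ((continuous_apply _).continuousAt.comp continuousAt_snd))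
  convert hZ.image_of_continuousOn hcont using 1
  ext p
  constructor
  · intro hp
    exact ⟨(p.1, fun j => trackErr C c r p.2 p.1 j.1 j.2), fun k hk => hp k hk,
      Prod.ext rfl (stateOfErr_trackErr p.2 p.1)⟩
  · rintro ⟨q, hq, rfl⟩ k hk
    simp only [trackErr_stateOfErr]
    exact hq k hk

/-- An integral curve of a cut-off field follows the closed loop while it stays in `K`. There the a
priori bounds put it in the interior of the thickened sets, so it cannot leave `K` before time `T`.
-/
theorem exists_admissible (hlip : sys.LocLipschitz) (hpd : sys.UniformlyPosDef)
    (hc : LocallyLipschitz c) (hr : LocallyLipschitz r) (hpos : ∀ t, 0 < r t)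
    (hw : ∀ i, Measurable (w i)) {Cw : ℝ} (hCw : 0 ≤ Cw) (hwb : ∀ i t, ‖w i t‖ ≤ Cw)
    (hx₀ : InDom C c r (0, x₀)) {T : ℝ} (hT : 0 ≤ T) :
    ∃ x, Admissible sys C hN c r w x₀ T x := by
  obtain ⟨_, _, _, _, S, hS, hadm⟩ := apriori_stages (hN := hN) hlip hpd hc hr hpos hw hCw hwb
    hx₀ T N le_rfl
  have hadm' : ∀ τ ∈ Icc 0 T, ∀ x, Admissible sys C hN c r w x₀ τ x → ∀ k hk, ∀ t ∈ Icc 0 τ,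
      (t, trackErr C c r (x t) t k hk) ∈ S k hk := fun τ hτ x hx k hk t ht =>
    ((hadm τ hτ x hx).1 k hk hk t ht).1
  -- Thickening the a priori sets inside the open domains gives room for continuation.
  choose S' hS'c hSS' hS' using fun k hk =>
    exists_compact_between (hS k hk hk).2 (isOpen_stageDom (C := C) hr.continuous k hk)
      (hS k hk hk).1
  set K : Set (ℝ × (Fin N → E n)) := {p | ∀ k hk, (p.1, trackErr C c r p.2 p.1 k hk) ∈ S' k hk}
  have hK : IsCompact K := isCompact_image_stateOfErr hc hr hpos hN hS' hS'c
  have hKdom : ∀ p ∈ K, InDom C c r p := fun p hp k hk => hS' k hk (hp k hk)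
  have hwint : ∀ i a b, IntervalIntegrable (w i) volume a b := fun i =>
    intervalIntegrable_of_measurable_of_bounded (hw i) (hwb i)
  -- Subtracting the primitive of the disturbance turns the Carathéodory equation into an ordinary
  -- one with a field that is locally Lipschitz on `K'`.
  set W : ℝ → Fin N → E n := fun t i => ∫ σ in (0 : ℝ)..t, w i σ
  have hW : ∀ t, LipAt W t := fun t => LipAt.pi fun i => by
    refine LipAt.of_lipschitzWith (K := ⟨Cw, hCw⟩) (LipschitzWith.of_dist_le_mul fun a b => ?_)
    rw [dist_eq_norm, Real.dist_eq]
    simp only [W]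
    rw [intervalIntegral.integral_interval_sub_left (hwint i 0 a) (hwint i 0 b)]
    exact intervalIntegral.norm_integral_le_of_norm_le_const fun σ _ => hwb i σ
  have hWc : Continuous W := continuous_iff_continuousAt.2 fun t => (hW t).continuousAt
  set K' : Set (ℝ × (Fin N → E n)) := (fun p => (p.1, p.2 - W p.1)) '' K
  have hK' : IsCompact K' :=
    hK.image (continuous_fst.prodMk (continuous_snd.sub (hWc.comp continuous_fst)))
  obtain ⟨H, α, hHc, hHG, hα0, hα⟩ := exists_integralCurve_of_lipAt_compact hK'
    (G := fun p => closedField sys C hN c r (p.1, p.2 + W p.1)) (by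
      rintro _ ⟨p, hp, rfl⟩
      have h1 : LipAt (fun q : ℝ × (Fin N → E n) => (q.1, q.2 + W q.1)) (p.1, p.2 - W p.1) :=
        LipAt.fst.prodMk (LipAt.snd.add (LipAt.comp (hW _) LipAt.fst))
      refine LipAt.comp (f := fun q : ℝ × (Fin N → E n) => (q.1, q.2 + W q.1))
        (g := closedField sys C hN c r) ?_ h1
      simp only [sub_add_cancel]
      exact lipAt_closedField hlip hN hc hr hpos (hKdom p hp)) x₀ hT
  have hαc : ContinuousOn α (Icc 0 T) := fun t ht => (hα t ht).continuousWithinAt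
  set x : ℝ → Fin N → E n := fun t => α t + W t
  have hxc : ContinuousOn x (Icc 0 T) := hαc.add hWc.continuousOn
  have hx0 : x 0 = x₀ := by
    funext i; simp [x, W, hα0]
  have hfield : ∀ t, (t, x t) ∈ K → H (t, α t) = closedField sys C hN c r (t, x t) := by
    intro t ht
    have h1 : (t, α t) ∈ K' := ⟨(t, x t), ht, by simp [x]⟩
    exact hHG h1
  have hprefix : ∀ τ ∈ Icc 0 T, (∀ t ∈ Icc 0 τ, (t, x t) ∈ K) →
      Admissible sys C hN c r w x₀ τ x := by
    intro τ hτ hmem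
    refine ⟨hxc.mono (Icc_subset_Icc_right hτ.2), hx0, fun t ht => hKdom _ (hmem t ht), ?_⟩
    have hHα : ContinuousOn (fun t => H (t, α t)) (Icc 0 T) :=
      hHc.comp_continuousOn (continuousOn_id.prodMk hαc)
    have hcf : ContinuousOn (fun t => closedField sys C hN c r (t, x t)) (Icc 0 τ) :=
      (hHα.mono (Icc_subset_Icc_right hτ.2)).congr fun t ht => (hfield t (hmem t ht)).symm
    have hint : ∀ i, ∀ t ∈ Icc 0 τ, IntervalIntegrable
        (fun σ => closedField sys C hN c r (σ, x σ) i + w i σ) volume 0 t := fun i t ht => by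
      refine IntervalIntegrable.add (ContinuousOn.intervalIntegrable ?_) (hwint i 0 t)
      rw [uIcc_of_le ht.1]
      exact ((continuous_apply i).comp_continuousOn hcf).mono (Icc_subset_Icc_right ht.2)
    have hzero : ∀ i, ∀ t ∈ Icc 0 τ, x t i - x 0 i
        = ∫ σ in (0 : ℝ)..t, (closedField sys C hN c r (σ, x σ) i + w i σ) := by
      intro i t ht
      have hcfi : IntervalIntegrable (fun σ => closedField sys C hN c r (σ, x σ) i) volume 0 t := by
        refine ContinuousOn.intervalIntegrable ?_
        rw [uIcc_of_le ht.1]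
        exact ((continuous_apply i).comp_continuousOn hcf).mono (Icc_subset_Icc_right ht.2)
      have htT : t ≤ T := ht.2.trans hτ.2
      have hftc : ∫ σ in (0 : ℝ)..t, closedField sys C hN c r (σ, x σ) i = α t i - α 0 i := by
        refine intervalIntegral.integral_eq_sub_of_hasDeriv_right_of_le ht.1
          (((continuous_apply i).comp_continuousOn hαc).mono (Icc_subset_Icc_right htT))
          (fun σ hσ => ?_) hcfi
        have h1 := hα σ ⟨hσ.1.le, hσ.2.le.trans htT⟩
        rw [hfield σ (hmem σ ⟨hσ.1.le, hσ.2.le.trans ht.2⟩)] at h1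
        have h2 := (h1.hasDerivAt (Icc_mem_nhds hσ.1 (hσ.2.trans_le htT))).hasDerivWithinAt
          (s := Ioi σ)
        exact hasDerivWithinAt_pi.1 h2 i
      rw [intervalIntegral.integral_add hcfi (hwint i 0 t), hftc]
      simp only [x, W, Pi.add_apply, intervalIntegral.integral_same, add_zero]
      abel
    intro i s hs t ht
    rw [← intervalIntegral.integral_interval_sub_left (hint i t ht) (hint i s hs), ← hzero i t ht,
      ← hzero i s hs]
    abel
  have hinit : (0, x 0) ∈ K := by
    -- On the degenerate interval `[0, 0]` a constant trajectory is admissible, so the a priori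
    -- bound applies to the initial state.
    have h1 : Admissible sys C hN c r w x₀ 0 (fun _ => x₀) := by
      refine ⟨continuousOn_const, rfl, fun t ht => ?_, fun i s hs t ht => ?_⟩
      · rwa [le_antisymm ht.2 ht.1]
      · rw [le_antisymm ht.2 ht.1, le_antisymm hs.2 hs.1]; simp
    intro k hk
    rw [hx0]
    exact interior_subset (hSS' k hk (hadm' 0 ⟨le_rfl, hT⟩ _ h1 k hk 0 ⟨le_rfl, le_rfl⟩))
  have hall : Icc 0 T ⊆ {t | (t, x t) ∈ K} := by
    refine IsClosed.Icc_subset_of_forall_mem_nhdsGT_of_Icc_subset ?_ hinit fun t ht hsub => ?_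
    · rw [inter_comm]
      exact (continuousOn_id.prodMk hxc).preimage_isClosed_of_isClosed isClosed_Icc hK.isClosed
    · have htT : t ∈ Icc 0 T := ⟨ht.1, ht.2.le⟩
      have h1 := hprefix t htT fun s hs => hsub hs
      have h2 : ∀ k hk, ∀ᶠ p in 𝓝 (t, x t), (p.1, trackErr C c r p.2 p.1 k hk) ∈ S' k hk := by
        intro k hk
        have h3 := hSS' k hk (hadm' t htT x h1 k hk t ⟨ht.1, le_rfl⟩)
        have h4 : ContinuousAt (fun p : ℝ × (Fin N → E n) => (p.1, trackErr C c r p.2 p.1 k hk))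
            (t, x t) := continuousAt_fst.prodMk
          (lipAt_trackErr hc hr hpos (h1.dom t ⟨ht.1, le_rfl⟩) k hk).continuousAt
        exact (h4.eventually_mem (isOpen_interior.mem_nhds h3)).mono fun p hp => interior_subset hp
      have h5 : ∀ᶠ p in 𝓝 (t, x t), p ∈ K := by
        have h6 : ∀ᶠ p in 𝓝 (t, x t), ∀ k : Fin N,
            (p.1, trackErr C c r p.2 p.1 k.1 k.2) ∈ S' k.1 k.2 :=
          eventually_all.2 fun k => h2 k.1 k.2
        exact h6.mono fun p hp k hk => hp ⟨k, hk⟩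
      have h7 : Tendsto (fun s => (s, x s)) (𝓝[>] t) (𝓝 (t, x t)) := by
        have : ContinuousWithinAt (fun s => (s, x s)) (Icc 0 T) t :=
          continuousWithinAt_id.prodMk (hxc t htT)
        refine Tendsto.mono_left this (nhdsWithin_le_iff.2 ?_)
        exact mem_of_superset (Ioo_mem_nhdsGT ht.2) fun s hs => ⟨ht.1.trans hs.1.le, hs.2.le⟩
      exact h7.eventually h5
  exact ⟨x, hprefix T ⟨hT, le_rfl⟩ fun t ht => hall ht⟩

/-- A trajectory of the closed loop with the same initial state agrees with an admissible one. -/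
theorem Admissible.eqOn {T : ℝ} {x z : ℝ → Fin N → E n}
    (hx : Admissible sys C hN c r w x₀ T x) (hlip : sys.LocLipschitz) (hc : LocallyLipschitz c)
    (hr : LocallyLipschitz r) (hpos : ∀ t, 0 < r t) (hT : 0 ≤ T)
    (hw : ∀ i a b, IntervalIntegrable (w i) volume a b) (hz0 : z 0 = x₀)
    (hzi : ∀ i, IntervalIntegrable
      (fun σ => closedField sys C hN c r (σ, z σ) i + w i σ) volume 0 T)
    (hz : ∀ i, ∀ t ∈ Icc 0 T, z t i = z 0 i
      + ∫ σ in (0 : ℝ)..t, (closedField sys C hN c r (σ, z σ) i + w i σ)) :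
    EqOn z x (Icc 0 T) := by
  have hzi' : ∀ i, ∀ a ∈ Icc 0 T, ∀ b ∈ Icc 0 T, IntervalIntegrable
      (fun σ => closedField sys C hN c r (σ, z σ) i + w i σ) volume a b := fun i a ha b hb =>
    (hzi i).mono_set (by rw [uIcc_of_le hT]; exact uIcc_subset_Icc ha hb)
  have hxi : ∀ i, ∀ a ∈ Icc 0 T, ∀ b ∈ Icc 0 T, IntervalIntegrable
      (fun σ => closedField sys C hN c r (σ, x σ) i + w i σ) volume a b := fun i a ha b hb => by
    refine IntervalIntegrable.add (ContinuousOn.intervalIntegrable ?_) (hw i a b)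
    exact ((continuous_apply i).comp_continuousOn
      (hx.continuousOn_field hlip hc hr hpos)).mono (uIcc_subset_Icc ha hb)
  have hzc : ContinuousOn z (Icc 0 T) := by
    refine continuousOn_pi.2 fun i => ?_
    refine ContinuousOn.congr (f := fun t => z 0 i
      + ∫ σ in (0 : ℝ)..t, (closedField sys C hN c r (σ, z σ) i + w i σ))
      (continuousOn_const.add ?_) (hz i)
    have := intervalIntegral.continuousOn_primitive_interval (μ := volume) (a := 0) (b := T)
      (f := fun σ => closedField sys C hN c r (σ, z σ) i + w i σ) (by
        rw [uIcc_of_le hT]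
        exact (intervalIntegrable_iff_integrableOn_Icc_of_le hT).1 (hzi i))
    rwa [uIcc_of_le hT] at this
  have hsub : Icc 0 T ⊆ {t | z t = x t} := by
    refine IsClosed.Icc_subset_of_forall_mem_nhdsGT_of_Icc_subset ?_ (hz0.trans hx.init.symm)
      fun t ht hsub => ?_
    · have := (hzc.sub hx.cont).preimage_isClosed_of_isClosed isClosed_Icc
        (isClosed_singleton (x := (0 : Fin N → E n)))
      convert this using 1
      ext t
      simp [sub_eq_zero, and_comm]
    have htT : t ∈ Icc 0 T := ⟨ht.1, ht.2.le⟩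
    have hzt : z t = x t := hsub ⟨ht.1, le_rfl⟩
    -- The competitor `z` is not assumed to stay in the domain; near an agreement time continuity
    -- puts both curves into the neighbourhood `U` of a point of `x`.
    obtain ⟨L, U, hU, hL⟩ := lipAt_closedField (hN := hN) hlip hc hr hpos (hx.dom t htT)
    have hlim : ∀ {y : ℝ → Fin N → E n}, ContinuousOn y (Icc 0 T) → y t = x t →
        ∀ᶠ s in 𝓝[≥] t, (s, y s) ∈ U := by
      intro y hy hyt
      have h1 : ContinuousWithinAt (fun s => (s, y s)) (Icc 0 T) t :=
        continuousWithinAt_id.prodMk (hy t htT)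
      have h2 : Tendsto (fun s => (s, y s)) (𝓝[≥] t) (𝓝 (t, x t)) := by
        rw [← hyt]
        refine Tendsto.mono_left h1 (nhdsWithin_le_iff.2 ?_)
        exact mem_of_superset (Ico_mem_nhdsGE ht.2) fun s hs => ⟨ht.1.trans hs.1, hs.2.le⟩
      exact h2.eventually hU
    have hsmall : ∀ᶠ s in 𝓝[≥] t, (L : ℝ) * (s - t) < 1 := by
      have : Tendsto (fun s => (L : ℝ) * (s - t)) (𝓝[≥] t) (𝓝 0) :=
        ((continuous_const.mul (continuous_id.sub continuous_const)).tendsto' t 0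
          (by simp)).mono_left nhdsWithin_le_nhds
      exact this.eventually_lt_const one_pos
    obtain ⟨b, hb, hbU⟩ := (mem_nhdsGE_iff_exists_Icc_subset).1
      (((hlim hzc hzt).and (hlim hx.cont rfl)).and (hsmall.and (Ico_mem_nhdsGE ht.2)))
    have hbT : ∀ s ∈ Icc t b, s ∈ Icc 0 T := fun s hs =>
      ⟨ht.1.trans hs.1, (hbU hs).2.2.2.le⟩
    -- The largest distance on `[t, b]` is at most `L (s - t) < 1` times itself, hence zero.
    obtain ⟨s, hs, hmax⟩ := (isCompact_Icc (a := t) (b := b)).exists_isMaxOn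
      ⟨t, le_rfl, (mem_Ioi.1 hb).le⟩ ((hzc.sub hx.cont).norm.mono hbT)
    have hle : ‖z s - x s‖ ≤ L * ‖z s - x s‖ * |s - t| := by
      refine (pi_norm_le_iff_of_nonneg (by positivity)).2 fun i => ?_
      have h0 : (0 : ℝ) ∈ Icc 0 T := ⟨le_rfl, hT⟩
      have h1 : (z s - x s) i = ∫ σ in t..s, ((closedField sys C hN c r (σ, z σ) i + w i σ)
          - (closedField sys C hN c r (σ, x σ) i + w i σ)) := by
        rw [intervalIntegral.integral_sub (hzi' i t htT s (hbT s hs)) (hxi i t htT s (hbT s hs)),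
          ← hx.incr i t htT s (hbT s hs), ← intervalIntegral.integral_interval_sub_left
            (hzi' i 0 h0 s (hbT s hs)) (hzi' i 0 h0 t htT)]
        have h2 := hz i s (hbT s hs)
        have h3 := hz i t htT
        rw [Pi.sub_apply, ← hzt, h2, h3]
        abel
      rw [h1]
      refine intervalIntegral.norm_integral_le_of_norm_le_const fun σ hσ => ?_
      rw [uIoc_of_le hs.1] at hσ
      have hσb : σ ∈ Icc t b := ⟨hσ.1.le, hσ.2.trans hs.2⟩
      have h4 := hL.dist_le_mul _ (hbU hσb).1.1 _ (hbU hσb).1.2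
      rw [add_sub_add_right_eq_sub]
      rw [dist_eq_norm, Prod.dist_eq, dist_self, dist_eq_norm, max_eq_right (norm_nonneg _)] at h4
      calc _ ≤ ‖closedField sys C hN c r (σ, z σ) - closedField sys C hN c r (σ, x σ)‖ :=
            norm_le_pi_norm (closedField sys C hN c r (σ, z σ)
              - closedField sys C hN c r (σ, x σ)) i
        _ ≤ L * ‖z σ - x σ‖ := h4
        _ ≤ L * ‖z s - x s‖ := by
            gcongr
            exact hmax hσb
    have hzero : ‖z s - x s‖ = 0 := by
      have h1 := (hbU hs).2.1
      rw [abs_of_nonneg (sub_nonneg.2 hs.1)] at hle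
      nlinarith [norm_nonneg (z s - x s)]
    refine mem_of_superset (Ioo_mem_nhdsGT (mem_Ioi.1 hb)) fun σ hσ => ?_
    have h1 : ‖z σ - x σ‖ ≤ ‖z s - x s‖ := hmax ⟨hσ.1.le, hσ.2.le⟩
    rw [hzero] at h1
    exact sub_eq_zero.1 (norm_le_zero_iff.1 h1)
  exact hsub

end Existence

/-! ### The solution on the half-line. -/

section Solution

variable {N n : ℕ} {C : ControlParams N n} {sys : PureFeedbackSystem N n} {hN : 0 < N}

theorem ref_congr {c c' : ℝ → E n} {r r' : ℝ → ℝ} {t : ℝ} (hc : c t = c' t) (hr : r t = r' t)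
    (x : Fin N → E n) (k : ℕ) (hk : k < N) : C.ref c r x t k hk = C.ref c' r' x t k hk := by
  induction k with
  | zero => simp only [PrTRAS.ControlParams.ref, hc, hr]
  | succ k ih => simp only [PrTRAS.ControlParams.ref, ih]

theorem Admissible.mono {c : ℝ → E n} {r : ℝ → ℝ} {w : Fin N → ℝ → E n} {x₀ : Fin N → E n}
    {τ T : ℝ} {x : ℝ → Fin N → E n} (hx : Admissible sys C hN c r w x₀ T x) (h : τ ≤ T) :
    Admissible sys C hN c r w x₀ τ x :=
  ⟨hx.cont.mono (Icc_subset_Icc_right h), hx.init, fun t ht => hx.dom t ⟨ht.1, ht.2.trans h⟩,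
    fun i s hs t ht => hx.incr i s ⟨hs.1, hs.2.trans h⟩ t ⟨ht.1, ht.2.trans h⟩⟩

/-- The closed loop has a unique solution for all time, and its output stays inside the tube, if
the centre and the radius of the tube are locally Lipschitz in time. -/
theorem exists_unique_closedLoop_solution (hlip : sys.LocLipschitz) (hpd : sys.UniformlyPosDef)
    {w : Fin N → ℝ → E n} (hw : IsDisturbance w) {c : ℝ → E n} {r : ℝ → ℝ}
    (hc : LocallyLipschitz fun t => c (max t 0)) (hr : LocallyLipschitz fun t => r (max t 0))
    (hpos : ∀ t, 0 ≤ t → 0 < r t) {x₀ : Fin N → E n} (hx₀ : ‖x₀ ⟨0, hN⟩ - c 0‖ < r 0)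
    (herr : C.InitialErrors c r x₀) :
    ∃ x : ℝ → Fin N → E n, x 0 = x₀ ∧
      (∀ T, 0 ≤ T → sys.IsSolutionOn (C.input hN c r) w x T) ∧
      (∀ T, 0 ≤ T → ∀ z : ℝ → Fin N → E n, z 0 = x₀ →
        sys.IsSolutionOn (C.input hN c r) w z T → ∀ t ∈ Icc 0 T, z t = x t) ∧
      ∀ t, 0 ≤ t → ‖x t ⟨0, hN⟩ - c t‖ < r t := by
  -- Centre and radius are extended by constants to negative times, and the disturbance by zero, so
  -- that the regularity and bounds assumed for `t ≥ 0` hold on the whole line.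
  set c' : ℝ → E n := fun t => c (max t 0)
  set r' : ℝ → ℝ := fun t => r (max t 0)
  have hc' : ∀ t, 0 ≤ t → c' t = c t := fun t ht => by simp only [c', max_eq_left ht]
  have hr' : ∀ t, 0 ≤ t → r' t = r t := fun t ht => by simp only [r', max_eq_left ht]
  have hpos' : ∀ t, 0 < r' t := fun t => hpos _ (le_max_right _ _)
  obtain ⟨hwm, Wb, hWb, hwW⟩ := hw
  obtain ⟨Cw, hCw0, hCw⟩ := hWb.exists_pos_norm_le
  set w' : Fin N → ℝ → E n := fun i => (Ici (0 : ℝ)).indicator (w i)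
  have hw' : ∀ i, Measurable (w' i) := fun i => (hwm i).indicator measurableSet_Ici
  have hwb : ∀ i t, ‖w' i t‖ ≤ Cw := fun i t => by
    by_cases ht : t ∈ Ici (0 : ℝ)
    · simpa only [w', indicator_of_mem ht] using hCw _ (hwW i t ht)
    · simpa only [w', indicator_of_notMem ht, norm_zero] using hCw0.le
  have hwint : ∀ i a b, IntervalIntegrable (w' i) volume a b := fun i =>
    intervalIntegrable_of_measurable_of_bounded (hw' i) (hwb i)
  have hdom₀ : InDom C c' r' (0, x₀) := by
    intro k hk
    cases k with
    | zero =>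
      change ‖x₀ ⟨0, hk⟩ - c' 0‖ < r' 0
      rwa [hc' 0 le_rfl, hr' 0 le_rfl]
    | succ k =>
      intro i
      change |(x₀ ⟨k + 1, hk⟩ - C.ref c' r' x₀ 0 k _) i| < _
      rw [ref_congr (hc' 0 le_rfl) (hr' 0 le_rfl)]
      simpa [PrTRAS.ControlParams.funnel] using herr k hk i
  have hex : ∀ T, 0 ≤ T → ∃ x, Admissible sys C hN c' r' w' x₀ T x := fun T hT =>
    exists_admissible hlip hpd hc hr hpos' hw' hCw0.le hwb hdom₀ hT
  have hvel : ∀ (x : Fin N → E n) (t : ℝ) (i : Fin N), 0 ≤ t →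
      sys.velocity x (C.input hN c r x t) (w i t) i
        = closedField sys C hN c' r' (t, x) i + w' i t := by
    intro x t i ht
    have h1 : C.input hN c r x t = C.input hN c' r' x t :=
      ref_congr (hc' t ht).symm (hr' t ht).symm x _ _
    rw [h1, velocity_eq_closedField]
    simp only [w', indicator_of_mem (mem_Ici.2 ht)]
  have huniq : ∀ T, 0 ≤ T → ∀ x, Admissible sys C hN c' r' w' x₀ T x →
      ∀ z : ℝ → Fin N → E n, z 0 = x₀ → sys.IsSolutionOn (C.input hN c r) w z T →
      EqOn z x (Icc 0 T) := by
    intro T hT x hx z hz0 hz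
    refine hx.eqOn hlip hc hr hpos' hT hwint hz0 (fun i => ?_) fun i t ht => ?_
    · refine (hz i).1.congr fun s hs => ?_
      rw [uIoc_of_le hT] at hs
      exact hvel _ _ _ hs.1.le
    · rw [(hz i).2 t ht]
      congr 1
      refine intervalIntegral.integral_congr fun s hs => ?_
      rw [uIcc_of_le ht.1] at hs
      exact hvel _ _ _ hs.1
  have hsol : ∀ T, 0 ≤ T → ∀ x y : ℝ → Fin N → E n, Admissible sys C hN c' r' w' x₀ T x →
      EqOn y x (Icc 0 T) → sys.IsSolutionOn (C.input hN c r) w y T := by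
    intro T hT x y hx hyx i
    have hxi : IntervalIntegrable
        (fun σ => closedField sys C hN c' r' (σ, x σ) i + w' i σ) volume 0 T := by
      refine IntervalIntegrable.add (ContinuousOn.intervalIntegrable ?_) (hwint i 0 T)
      rw [uIcc_of_le hT]
      exact (continuous_apply i).comp_continuousOn (hx.continuousOn_field hlip hc hr hpos')
    refine ⟨hxi.congr fun s hs => ?_, fun t ht => ?_⟩
    · rw [uIoc_of_le hT] at hs
      simp only [hvel _ _ _ hs.1.le, hyx ⟨hs.1.le, hs.2⟩]
    · have h1 := hx.incr i 0 ⟨le_rfl, hT⟩ t ht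
      rw [hyx ht, hyx ⟨le_rfl, hT⟩, ← sub_eq_iff_eq_add', h1]
      refine intervalIntegral.integral_congr fun s hs => ?_
      rw [uIcc_of_le ht.1] at hs
      simp only [hvel _ _ _ hs.1, hyx ⟨hs.1, hs.2.trans ht.2⟩]
  -- The global solution at time `t` is the value at `t` of a solution with horizon `t`; by
  -- uniqueness it agrees with the solution for any longer horizon.
  choose X hX using hex
  have hcons : ∀ T (hT : 0 ≤ T), EqOn (fun t => X (max t 0) (le_max_right _ _) t) (X T hT)
      (Icc 0 T) := by
    intro T hT t ht
    have h1 : ∀ s (hs : 0 ≤ s), s = t → X s hs t = X T hT t := by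
      rintro s hs rfl
      have h2 := (hX T hT).mono ht.2
      exact huniq s hs _ h2 _ (hX s hs).init
        (hsol s hs _ _ (hX s hs) fun _ _ => rfl) ⟨hs, le_rfl⟩
    exact h1 _ _ (max_eq_left ht.1)
  refine ⟨fun t => X (max t 0) (le_max_right _ _) t, ?_, fun T hT => ?_,
    fun T hT z hz0 hz t ht => ?_, fun t ht => ?_⟩
  · exact (hcons 0 le_rfl ⟨le_rfl, le_rfl⟩).trans (hX 0 le_rfl).init
  · exact hsol T hT _ _ (hX T hT) (hcons T hT)
  · exact (huniq T hT _ (hX T hT) z hz0 hz ht).trans (hcons T hT ht).symm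
  · have h1 := (hX t ht).dom t ⟨ht, le_rfl⟩ 0 hN
    have h2 : ‖X t ht t ⟨0, hN⟩ - c' t‖ < r' t := h1
    rw [hc' t ht, hr' t ht] at h2
    have h3 := hcons t ht ⟨ht, le_rfl⟩
    simp only at h3 ⊢
    rwa [h3]

end Solution

/-! ### Isotropic Gaussian vectors -/

-- The square root of `σ² I` is `σ I`. All obstacle probabilities thus become values of one fixed
-- measure on sets that move with time.
open scoped MatrixOrder in
theorem multivariateGaussian_isotropic {n : ℕ} (μ : E n) {σ : ℝ} (hσ : 0 ≤ σ) :
    multivariateGaussian μ (σ ^ 2 • (1 : Matrix (Fin n) (Fin n) ℝ))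
      = (stdGaussian (E n)).map (fun z => μ + σ • z) := by
  have h : CFC.sqrt (σ ^ 2 • (1 : Matrix (Fin n) (Fin n) ℝ)) = σ • 1 := by
    refine CFC.sqrt_unique ?_ ?_
    · rw [smul_mul_smul_comm, one_mul, pow_two]
    · exact Matrix.nonneg_iff_posSemidef.2 (Matrix.PosSemidef.one.smul hσ)
  rw [multivariateGaussian, h]
  congr 1
  funext z
  simp

/-- By Fubini: with all coordinates but the first fixed, the sphere leaves at most two values for
the first, and the one-dimensional Gaussian has no atoms. In dimension zero the measure is a point
mass and this fails. -/
theorem stdGaussian_sphere {n : ℕ} (hn : 0 < n) (b : E n) (ρ : ℝ) :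
    stdGaussian (E n) (Metric.sphere b ρ) = 0 := by
  obtain ⟨m, rfl⟩ : ∃ m, n = m + 1 := ⟨n - 1, by omega⟩
  have hmeas : Measurable (WithLp.toLp 2 : (Fin (m + 1) → ℝ) → E (m + 1)) := by fun_prop
  rw [← map_pi_eq_stdGaussian, Measure.map_apply hmeas Metric.isClosed_sphere.measurableSet]
  have hmp := measurePreserving_piFinSuccAbove (fun _ : Fin (m + 1) => gaussianReal 0 1) 0
  have hinv := hmp.symm
  rw [← hinv.measure_preimage (hmeas Metric.isClosed_sphere.measurableSet).nullMeasurableSet]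
  have hs : MeasurableSet ((MeasurableEquiv.piFinSuccAbove (fun _ : Fin (m + 1) => ℝ) 0).symm ⁻¹'
      (WithLp.toLp 2 ⁻¹' Metric.sphere b ρ)) :=
    (MeasurableEquiv.measurable _) (hmeas Metric.isClosed_sphere.measurableSet)
  have : NullSingletonClass (gaussianReal 0 1) := nullSingletonClass_gaussianReal one_ne_zero
  rw [Measure.prod_apply_symm hs]
  refine (lintegral_congr fun y => ?_).trans lintegral_zero
  refine Set.Finite.measure_zero (Set.Finite.subset (s := {b 0 + √(ρ ^ 2 - ∑ i : Fin m,
    (y i - b i.succ) ^ 2), b 0 - √(ρ ^ 2 - ∑ i : Fin m, (y i - b i.succ) ^ 2)})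
    (by simp) fun x hx => ?_) _
  have h1 : ‖(WithLp.toLp 2 (Fin.cons x y : Fin (m + 1) → ℝ) : E (m + 1)) - b‖ = ρ := by
    simpa [MeasurableEquiv.piFinSuccAbove, Fin.insertNthEquiv, dist_eq_norm] using hx
  have h2 : (x - b 0) ^ 2 = ρ ^ 2 - ∑ i : Fin m, (y i - b i.succ) ^ 2 := by
    rw [← h1, EuclideanSpace.real_norm_sq_eq, Fin.sum_univ_succ]
    simp
  rw [← h2, Real.sqrt_sq_eq_abs]
  rcases abs_choice (x - b 0) with h | h <;> rw [h] <;> simp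

/-- The indicators of the balls converge off the limiting sphere, which is null. -/
theorem tendsto_stdGaussian_ball {n : ℕ} (hn : 0 < n) {ι : Type*} {l : Filter ι}
    [l.IsCountablyGenerated] {b : ι → E n} {ρ : ι → ℝ} {b₀ : E n} {ρ₀ : ℝ}
    (hb : Tendsto b l (𝓝 b₀)) (hρ : Tendsto ρ l (𝓝 ρ₀)) :
    Tendsto (fun i => (stdGaussian (E n)).real (Metric.ball (b i) (ρ i))) l
      (𝓝 ((stdGaussian (E n)).real (Metric.ball b₀ ρ₀))) := by
  refine (ENNReal.tendsto_toReal (measure_ne_top _ _)).comp ?_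
  refine tendsto_measure_of_ae_tendsto_indicator_of_isFiniteMeasure l
    Metric.isOpen_ball.measurableSet (fun i => Metric.isOpen_ball.measurableSet) ?_
  have h0 : ∀ᵐ z ∂(stdGaussian (E n)), z ∉ Metric.sphere b₀ ρ₀ :=
    measure_eq_zero_iff_ae_notMem.1 (stdGaussian_sphere hn b₀ ρ₀)
  filter_upwards [h0] with z hz
  have hd : Tendsto (fun i => dist z (b i) - ρ i) l (𝓝 (dist z b₀ - ρ₀)) :=
    (tendsto_const_nhds.dist hb).sub hρ
  rcases lt_or_gt_of_ne (show dist z b₀ ≠ ρ₀ from hz) with h | h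
  · filter_upwards [hd.eventually_lt_const (sub_neg.2 h)] with i hi
    simp only [Metric.mem_ball]
    exact iff_of_true (sub_neg.1 hi) h
  · filter_upwards [hd.eventually_const_lt (sub_pos.2 h)] with i hi
    simp only [Metric.mem_ball]
    exact iff_of_false (not_lt.2 (sub_pos.1 hi).le) (not_lt.2 h.le)

/-! ### Quantiles of the distance to a random point -/

section Quantile

variable {F : Type*} [NormedAddCommGroup F] [MeasurableSpace F] (ν : Measure F) {p : ℝ}

/-- The distribution function of the squared distance of `b` to a `ν`-random point. -/
noncomputable def sqDistCdf (b : F) (a : ℝ) : ℝ := ν.real {z | ‖b - z‖ ^ 2 ≤ a}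

variable {ν} in
theorem nonneg_of_le_sqDistCdf {b : F} {a : ℝ} (hp : 0 < p) (ha : p ≤ sqDistCdf ν b a) :
    0 ≤ a := by
  by_contra! h
  have : {z : F | ‖b - z‖ ^ 2 ≤ a} = ∅ := by
    ext z
    simp only [mem_ofPred_eq, mem_empty_iff_false, iff_false, not_le]
    exact h.trans_le (sq_nonneg _)
  rw [sqDistCdf, this, measureReal_empty] at ha
  linarith

/-- Together with `exists_le_sqDistCdf` this makes the infimum in `quantile` a genuine one, not the
default value `0`. -/
theorem bddBelow_quantile_set (b : F) (hp : 0 < p) : BddBelow {a | p ≤ sqDistCdf ν b a} :=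
  ⟨0, fun _ ha => nonneg_of_le_sqDistCdf hp ha⟩

variable [IsProbabilityMeasure ν]

theorem exists_le_sqDistCdf (b : F) (hp : p < 1) : ∃ a, p ≤ sqDistCdf ν b a := by
  have hun : ⋃ k : ℕ, {z : F | ‖b - z‖ ^ 2 ≤ k} = univ :=
    eq_univ_of_forall fun z => mem_iUnion.2 (exists_nat_ge (‖b - z‖ ^ 2))
  have hmono : Monotone fun k : ℕ => {z : F | ‖b - z‖ ^ 2 ≤ k} := fun i j hij z hz =>
    le_trans (mem_ofPred_eq ▸ hz) (by exact_mod_cast hij)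
  have h := (ENNReal.tendsto_toReal (measure_ne_top ν _)).comp
    (tendsto_measure_iUnion_atTop (μ := ν) hmono)
  rw [hun, measure_univ, ENNReal.toReal_one] at h
  obtain ⟨k, hk⟩ := (h.eventually_const_lt hp).exists
  exact ⟨k, hk.le⟩

/-- The ball of radius `√a` about `b` lies in the ball of radius `√a + ‖b - b'‖` about `b'`. The
Lipschitz bound follows with no regularity of the distribution function. -/
theorem sqrt_quantile_le_add (hp : p ∈ Ioo (0 : ℝ) 1) (b b' : F) :
    √(quantile (sqDistCdf ν b') p) ≤ √(quantile (sqDistCdf ν b) p) + ‖b - b'‖ := by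
  have hkey : ∀ a ∈ {a | p ≤ sqDistCdf ν b a}, √(quantile (sqDistCdf ν b') p) ≤ √a + ‖b - b'‖ := by
    intro a ha
    have ha0 := nonneg_of_le_sqDistCdf hp.1 ha
    refine Real.sqrt_le_iff.2 ⟨by positivity, csInf_le (bddBelow_quantile_set ν b' hp.1) ?_⟩
    refine le_trans ha (measureReal_mono fun z hz => ?_)
    have h1 : ‖b - z‖ ≤ √a := Real.le_sqrt_of_sq_le hz
    have h2 : ‖b' - z‖ ≤ ‖b - z‖ + ‖b - b'‖ := by
      calc ‖b' - z‖ = ‖(b - z) - (b - b')‖ := by congr 1; abel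
        _ ≤ _ := norm_sub_le _ _
    exact pow_le_pow_left₀ (norm_nonneg _) (by linarith) 2
  rw [← sub_le_iff_le_add]
  rcases le_or_gt (√(quantile (sqDistCdf ν b') p) - ‖b - b'‖) 0 with h | h
  · exact h.trans (Real.sqrt_nonneg _)
  refine Real.le_sqrt_of_sq_le (le_csInf (exists_le_sqDistCdf ν b hp.2) fun a ha => ?_)
  have h1 := hkey a ha
  rw [← Real.le_sqrt' h]
  linarith

theorem lipschitzWith_sqrt_quantile (hp : p ∈ Ioo (0 : ℝ) 1) :
    LipschitzWith 1 fun b : F => √(quantile (sqDistCdf ν b) p) := by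
  refine LipschitzWith.of_le_add fun b b' => ?_
  rw [dist_comm, dist_eq_norm]
  exact sqrt_quantile_le_add ν hp b' b

/-- Below the infimum the distribution function is less than `p`, and the open ball is an increasing
union of closed balls with squared radii below it. Continuity of the distribution function is not
needed. -/
theorem measureReal_lt_quantile_le (hp : 0 < p) (b : F) :
    ν.real {z | ‖b - z‖ < √(quantile (sqDistCdf ν b) p)} ≤ p := by
  set Q := quantile (sqDistCdf ν b) p
  have hun : {z : F | ‖b - z‖ < √Q} ⊆ ⋃ k : ℕ, {z : F | ‖b - z‖ ^ 2 ≤ Q - 1 / (k + 1)} := by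
    intro z hz
    have h1 : 0 < Q - ‖b - z‖ ^ 2 := by
      have := (Real.lt_sqrt (norm_nonneg _)).1 hz
      linarith
    obtain ⟨k, hk⟩ := exists_nat_one_div_lt h1
    refine mem_iUnion.2 ⟨k, ?_⟩
    change ‖b - z‖ ^ 2 ≤ Q - 1 / (k + 1)
    linarith
  have hmono : Monotone fun k : ℕ => {z : F | ‖b - z‖ ^ 2 ≤ Q - 1 / ((k : ℝ) + 1)} :=
    fun i j hij z hz => by
      have h1 : 1 / ((j : ℝ) + 1) ≤ 1 / ((i : ℝ) + 1) := Nat.one_div_le_one_div hij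
      have h2 : ‖b - z‖ ^ 2 ≤ Q - 1 / ((i : ℝ) + 1) := hz
      change ‖b - z‖ ^ 2 ≤ Q - 1 / ((j : ℝ) + 1)
      linarith
  have h := (ENNReal.tendsto_toReal (measure_ne_top ν _)).comp
    (tendsto_measure_iUnion_atTop (μ := ν) hmono)
  refine (measureReal_mono hun).trans (le_of_tendsto h (Eventually.of_forall fun k => ?_))
  have h1 : Q - 1 / ((k : ℝ) + 1) ∉ {a | p ≤ sqDistCdf ν b a} :=
    notMem_of_lt_csInf (sub_lt_self _ (by positivity)) (bddBelow_quantile_set ν b hp)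
  exact (not_le.1 h1).le

end Quantile

/-! ### Obstacles -/

section Obstacle

variable {Ω : Type*} [MeasurableSpace Ω] {P : Measure Ω} {n no : ℕ}
  (ob : Obstacles P n no)

/-- The standardized position of `x` relative to obstacle `j`. -/
noncomputable def stdPos (j : Fin no) (t : ℝ) (x : E n) : E n :=
  (ob.sd j t)⁻¹ • (x - ob.mean j t)

theorem measureReal_centre_mem {j : Fin no} {t : ℝ} (ht : 0 ≤ t) {A : Set (E n)}
    (hA : MeasurableSet A) : P.real {ω | ob.centre j t ω ∈ A}
      = (stdGaussian (E n)).real {z | ob.mean j t + ob.sd j t • z ∈ A} := by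
  have hlaw := ob.law j t ht
  have hm : Measurable fun z : E n => ob.mean j t + ob.sd j t • z := by fun_prop
  have h1 : P.real {ω | ob.centre j t ω ∈ A} = (P.map (ob.centre j t)).real A := by
    rw [map_measureReal_apply_of_aemeasurable hlaw.aemeasurable hA]; rfl
  rw [h1, hlaw.map_eq, multivariateGaussian_isotropic _ (ob.sd_pos j t ht).le,
    map_measureReal_apply hm hA]
  rfl

theorem norm_sub_eq_sd_mul {j : Fin no} {t : ℝ} (ht : 0 ≤ t) (x z : E n) :
    ‖x - (ob.mean j t + ob.sd j t • z)‖ = ob.sd j t * ‖stdPos ob j t x - z‖ := by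
  have hσ := ob.sd_pos j t ht
  have h : x - (ob.mean j t + ob.sd j t • z) = ob.sd j t • (stdPos ob j t x - z) := by
    rw [stdPos, smul_sub, smul_inv_smul₀ hσ.ne']; abel
  rw [h, norm_smul, Real.norm_of_nonneg hσ.le]

theorem measureReal_dist_lt {j : Fin no} {t : ℝ} (ht : 0 ≤ t) (x : E n) (ρ : ℝ) :
    P.real {ω | ‖x - ob.centre j t ω‖ < ρ}
      = (stdGaussian (E n)).real (Metric.ball (stdPos ob j t x) (ρ / ob.sd j t)) := by
  have h := measureReal_centre_mem ob (j := j) ht (A := {y | ‖x - y‖ < ρ})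
    (measurableSet_lt (by fun_prop) measurable_const)
  refine h.trans (congrArg _ ?_)
  ext z
  have hσ := ob.sd_pos j t ht
  change ‖x - (ob.mean j t + ob.sd j t • z)‖ < ρ ↔ _
  rw [norm_sub_eq_sd_mul ob ht, Metric.mem_ball, dist_comm, dist_eq_norm, lt_div_iff₀ hσ, mul_comm]

variable [IsProbabilityMeasure P]

theorem measureReal_le_dist {j : Fin no} {t : ℝ} (ht : 0 ≤ t) (x : E n) (ρ : ℝ) :
    P.real {ω | ρ ≤ ‖x - ob.centre j t ω‖} = 1 - P.real {ω | ‖x - ob.centre j t ω‖ < ρ} := by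
  have hm : NullMeasurableSet {ω | ‖x - ob.centre j t ω‖ < ρ} P := by
    have := (ob.law j t ht).aemeasurable
    exact nullMeasurableSet_lt (by fun_prop) (by fun_prop)
  rw [← probReal_compl_eq_one_sub₀ hm]
  congr 1
  ext ω
  simp

theorem distCdf_eq_sqDistCdf (c : ℝ → E n) {j : Fin no} {t : ℝ} (ht : 0 ≤ t) :
    distCdf ob c j t = sqDistCdf (stdGaussian (E n)) (stdPos ob j t (c t)) := by
  funext a
  have haem := (ob.law j t ht).aemeasurable
  have haem' : AEMeasurable (fun ω => ‖(ob.sd j t)⁻¹ • (c t - ob.centre j t ω)‖ ^ 2) P := by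
    fun_prop
  have := Measure.isProbabilityMeasure_map haem'
  rw [distCdf, cdf_eq_real, map_measureReal_apply_of_aemeasurable haem' measurableSet_Iic]
  refine (measureReal_centre_mem ob (j := j) ht
    (A := {y | ‖(ob.sd j t)⁻¹ • (c t - y)‖ ^ 2 ≤ a})
    (measurableSet_le (by fun_prop) measurable_const)).trans (congrArg _ ?_)
  ext z
  have hσ := ob.sd_pos j t ht
  change ‖(ob.sd j t)⁻¹ • (c t - (ob.mean j t + ob.sd j t • z))‖ ^ 2 ≤ a ↔ _
  rw [norm_smul, norm_sub_eq_sd_mul ob ht, norm_inv, Real.norm_of_nonneg hσ.le,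
    inv_mul_cancel_left₀ hσ.ne']
  rfl

variable {ob}

theorem dHat_eq (task : RASTask ob) (c : ℝ → E n) (j : Fin no) {t : ℝ} (ht : 0 ≤ t) :
    dHat task c j t = ob.sd j t * √(quantile (sqDistCdf (stdGaussian (E n))
      (stdPos ob j t (c t))) (1 - task.eps j)) - ob.radius j t := by
  rw [dHat, distCdf_eq_sqDistCdf ob c ht]

/-- A point that is at most `dHat` away from the centre avoids the obstacle with the required
probability. -/
theorem eps_le_of_dist_le_dHat (task : RASTask ob) (c : ℝ → E n) (j : Fin no)
    (heps : task.eps j < 1) {t : ℝ} (ht : 0 ≤ t) {y : E n} (hy : ‖y - c t‖ ≤ dHat task c j t) :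
    task.eps j ≤ P.real {ω | ob.radius j t ≤ ‖y - ob.centre j t ω‖} := by
  have hσ := ob.sd_pos j t ht
  set Q := √(quantile (sqDistCdf (stdGaussian (E n)) (stdPos ob j t (c t))) (1 - task.eps j))
  rw [dHat_eq task c j ht] at hy
  have h1 : P.real {ω | ‖c t - ob.centre j t ω‖ < ob.sd j t * Q} ≤ 1 - task.eps j := by
    rw [measureReal_dist_lt ob ht, mul_div_cancel_left₀ _ hσ.ne']
    refine le_trans (le_of_eq (congrArg _ ?_)) (measureReal_lt_quantile_le _
      (sub_pos.2 heps) (stdPos ob j t (c t)))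
    ext z
    rw [Metric.mem_ball, dist_comm, dist_eq_norm]
    rfl
  rw [measureReal_le_dist ob ht]
  -- If `y` hits the obstacle, then the centre is closer to it than `radius + dHat = sd * Q`.
  suffices h : P.real {ω | ‖y - ob.centre j t ω‖ < ob.radius j t}
      ≤ P.real {ω | ‖c t - ob.centre j t ω‖ < ob.sd j t * Q} by linarith
  refine measureReal_mono fun ω hω => ?_
  have h2 : ‖y - ob.centre j t ω‖ < ob.radius j t := hω
  have h3 : ‖c t - ob.centre j t ω‖ ≤ ‖y - ob.centre j t ω‖ + ‖y - c t‖ := by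
    calc _ = ‖(y - ob.centre j t ω) - (y - c t)‖ := by congr 1; abel
      _ ≤ _ := norm_sub_le _ _
  change ‖c t - ob.centre j t ω‖ < ob.sd j t * Q
  linarith

end Obstacle

/-! ### Functions on the half-line -/

theorem LocallyLipschitzOn.comp_max {F : Type*} [PseudoMetricSpace F] {f : ℝ → F}
    (hf : LocallyLipschitzOn (Ici 0) f) : LocallyLipschitz fun t => f (max t 0) := by
  intro t
  obtain ⟨K, u, hu, h⟩ := hf (le_max_right t 0)
  have hmax : LipschitzWith 1 fun t : ℝ => max t 0 := LipschitzWith.id.max_const 0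
  have hlim : Tendsto (fun s : ℝ => max s 0) (𝓝 t) (𝓝[Ici 0] (max t 0)) :=
    tendsto_nhdsWithin_iff.2 ⟨hmax.continuous.continuousAt,
      Eventually.of_forall fun s => le_max_right s 0⟩
  exact ⟨K * 1, _, hlim hu, h.comp hmax.lipschitzOnWith fun s hs => hs⟩

theorem locallyLipschitzOn_of_hasDerivWithinAt {F : Type*} [NormedAddCommGroup F]
    [NormedSpace ℝ F] {f f' : ℝ → F} (hf : ∀ t ∈ Ici (0 : ℝ), HasDerivWithinAt f (f' t) (Ici 0) t)
    (hf' : ContinuousOn f' (Ici 0)) : LocallyLipschitzOn (Ici 0) f := by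
  intro t ht
  have h1 : ∀ᶠ s in 𝓝[Ici 0] t, ‖f' s‖ < ‖f' t‖ + 1 :=
    (hf' t ht).norm.eventually_lt_const (lt_add_one _)
  obtain ⟨ε, hε, hball⟩ := Metric.mem_nhdsWithin_iff.1 h1
  refine ⟨‖f' t‖₊ + 1, Metric.ball t ε ∩ Ici 0,
    inter_mem (mem_nhdsWithin_of_mem_nhds (Metric.ball_mem_nhds t hε)) self_mem_nhdsWithin, ?_⟩
  refine ((convex_ball t ε).inter (convex_Ici 0)).lipschitzOnWith_of_nnnorm_hasDerivWithin_le
    (f' := f') (fun s hs => (hf s hs.2).mono inter_subset_right) fun s hs => ?_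
  rw [← NNReal.coe_le_coe]
  have h2 : ‖f' s‖ < ‖f' t‖ + 1 := hball hs
  exact h2.le

/-! ### The cube root -/

theorem cbrt_eq (a : ℝ) : cbrt a = (max a 0) ^ (1 / 3 : ℝ) - (max (-a) 0) ^ (1 / 3 : ℝ) := by
  rcases lt_trichotomy a 0 with h | h | h
  · rw [cbrt, Real.sign_of_neg h, abs_of_neg h, max_eq_right h.le, max_eq_left (by linarith),
      Real.zero_rpow (by norm_num)]
    ring
  · subst h; simp [cbrt]
  · rw [cbrt, Real.sign_of_pos h, abs_of_pos h, max_eq_left h.le, max_eq_right (by linarith),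
      Real.zero_rpow (by norm_num)]
    ring

theorem continuous_cbrt : Continuous cbrt := by
  have h : cbrt = fun a => (max a 0) ^ (1 / 3 : ℝ) - (max (-a) 0) ^ (1 / 3 : ℝ) := funext cbrt_eq
  rw [h]
  exact ((continuous_id.max continuous_const).rpow_const fun _ => Or.inr (by norm_num)).sub
    ((continuous_neg.max continuous_const).rpow_const fun _ => Or.inr (by norm_num))

theorem continuous_cbrtVec {n : ℕ} : Continuous (cbrtVec : E n → E n) := by
  refine (PiLp.continuous_toLp 2 _).comp (continuous_pi fun i => continuous_cbrt.comp ?_)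
  exact (EuclideanSpace.proj i : E n →L[ℝ] ℝ).continuous

/-- It makes the cube-root equation autonomous in `y²`, where powers of a nonnegative base suffice.
-/
theorem mul_cbrt (a : ℝ) : a * cbrt a = (a ^ 2) ^ (2 / 3 : ℝ) := by
  have h1 : a * cbrt a = |a| * |a| ^ (1 / 3 : ℝ) := by
    rcases lt_trichotomy a 0 with h | h | h
    · rw [cbrt, Real.sign_of_neg h, abs_of_neg h]; ring
    · subst h; simp [cbrt]
    · rw [cbrt, Real.sign_of_pos h, abs_of_pos h]; ring
  rw [h1, ← sq_abs a]
  rcases (abs_nonneg a).eq_or_lt with h | h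
  · rw [← h]; norm_num
  · rw [← Real.rpow_natCast, ← Real.rpow_mul h.le]
    nth_rewrite 1 [← Real.rpow_one |a|]
    rw [← Real.rpow_add h]
    norm_num

/-- Solutions of `y' = -k y^{1/3}` vanish in finite time. -/
theorem eventually_zero_of_cbrt_ode {y : ℝ → ℝ} {k t₁ : ℝ} (hk : 0 < k)
    (hy : ∀ t, t₁ ≤ t → HasDerivWithinAt y (-(k * cbrt (y t))) (Ici t₁) t) :
    ∃ t₂, ∀ t, t₂ ≤ t → y t = 0 := by
  have hsq : ∀ t, t₁ ≤ t → HasDerivWithinAt (fun t => y t ^ 2)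
      (-(2 * k * (y t ^ 2) ^ (2 / 3 : ℝ))) (Ici t₁) t := fun t ht => by
    refine ((hy t ht).pow 2).congr_deriv ?_
    rw [← mul_cbrt]; simp; ring
  -- Since `y²` decreases, a single zero is enough.
  have hanti : AntitoneOn (fun t => y t ^ 2) (Ici t₁) := by
    refine antitoneOn_of_deriv_nonpos (convex_Ici _) (fun t ht => (hsq t ht).continuousWithinAt)
      ?_ ?_ <;> rw [interior_Ici] <;> intro t ht
    · exact ((hsq t (le_of_lt ht)).hasDerivAt
        (Ici_mem_nhds ht)).differentiableAt.differentiableWithinAt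
    · rw [((hsq t (le_of_lt ht)).hasDerivAt (Ici_mem_nhds ht)).deriv]
      have : 0 ≤ (y t ^ 2) ^ (2 / 3 : ℝ) := by positivity
      nlinarith
  by_cases hz : ∃ t₂, t₁ ≤ t₂ ∧ y t₂ = 0
  · obtain ⟨t₂, h1, h2⟩ := hz
    refine ⟨t₂, fun t ht => ?_⟩
    have := hanti h1 (h1.trans ht) ht
    simp only [h2] at this
    nlinarith [sq_nonneg (y t)]
  exfalso
  push Not at hz
  -- While `y` does not vanish, `(y²)^(1/3)` decreases at the constant rate `2k/3`.
  set φ : ℝ → ℝ := fun t => (y t ^ 2) ^ (1 / 3 : ℝ) + 2 * k / 3 * t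
  have hφ : ∀ t, t₁ ≤ t → HasDerivWithinAt φ 0 (Ici t₁) t := fun t ht => by
    have hpos : 0 < y t ^ 2 := by have := hz t ht; positivity
    have h1 := ((hsq t ht).rpow_const (p := 1 / 3) (Or.inl hpos.ne')).add
      (((hasDerivWithinAt_id t (Ici t₁)).const_mul (2 * k / 3)))
    refine h1.congr_deriv ?_
    have h2 : (y t ^ 2) ^ (2 / 3 : ℝ) * (y t ^ 2) ^ (1 / 3 - 1 : ℝ) = 1 := by
      rw [← Real.rpow_add hpos]; norm_num
    linear_combination (-(2 * k / 3)) * h2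
  -- At this time the conservation law would give `(y t²)^(1/3) = -1`.
  set t := t₁ + (3 / (2 * k)) * ((y t₁ ^ 2) ^ (1 / 3 : ℝ) + 1)
  have htt : t₁ ≤ t := by
    have : 0 ≤ (y t₁ ^ 2) ^ (1 / 3 : ℝ) := by positivity
    simp only [t]
    have : 0 ≤ (3 / (2 * k)) * ((y t₁ ^ 2) ^ (1 / 3 : ℝ) + 1) := by positivity
    linarith
  have hconst := constant_of_has_deriv_right_zero (f := φ) (a := t₁) (b := t)
    (fun s hs => ((hφ s hs.1).continuousWithinAt).mono fun u hu => hu.1)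
    (fun s hs => (hφ s hs.1).mono (Ici_subset_Ici.2 hs.1)) t ⟨htt, le_rfl⟩
  have h0 : 0 ≤ (y t ^ 2) ^ (1 / 3 : ℝ) := by positivity
  have h3 : 2 * k / 3 * t = 2 * k / 3 * t₁ + ((y t₁ ^ 2) ^ (1 / 3 : ℝ) + 1) := by
    simp only [t]; field_simp
  simp only [φ] at hconst
  linarith

/-! ### Regularity and geometry of the tube. -/

section Tube

variable {Ω : Type*} [MeasurableSpace Ω] {P : Measure Ω} {n no : ℕ}
  {ob : Obstacles P n no} {task : RASTask ob} {D : TubeDesign task} {v : Fin no → ℝ → E n}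
  {c : ℝ → E n} {r : ℝ → ℝ}

theorem CentreLaw.continuousOn (hc : D.CentreLaw v c) : ContinuousOn c (Ici 0) :=
  fun t ht => (hc.ode t ht).continuousWithinAt

theorem continuousOn_stdPos (hc : ContinuousOn c (Ici 0)) (j : Fin no) :
    ContinuousOn (fun t => stdPos ob j t (c t)) (Ici 0) :=
  ((ob.sd_smooth j).continuousOn.inv₀ fun t ht => (ob.sd_pos j t ht).ne').smul
    (hc.sub (ob.mean_smooth j).continuousOn)

/-- For positive `q`, the difference of reciprocals changes sign exactly at `q = pd`. In this form
`theta` is visibly continuous across the switch. -/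
theorem theta_eq {j : Fin no} {t : ℝ} (hq : task.eps j < D.q j (c t) t) :
    D.theta c j t = max (1 / D.q j (c t) t - 1 / D.pd j) 0 := by
  have h0 := (task.eps_mem j).1
  have h1 := (D.pd_mem j).1
  rw [PrTRAS.TubeDesign.theta]
  split_ifs with h
  · rw [max_eq_left (sub_nonneg.2 (one_div_le_one_div_of_le (h0.trans hq) h))]
  · rw [max_eq_right (sub_nonpos.2 (one_div_le_one_div_of_le (h0.trans h1) (not_le.1 h).le))]

theorem eps_lt_one (D : TubeDesign task) (j : Fin no) : task.eps j < 1 :=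
  ((D.pd_mem j).1).trans_le (D.pd_mem j).2

/-- Each summand inside the logarithm is at most the whole sum, so the smooth minimum lies below
each distance. -/
theorem d_le_dHat (j : Fin no) (t : ℝ) : D.d c t ≤ dHat task c j t := by
  have hν := D.nu_pos
  have h1 : Real.exp (-D.nu * dHat task c j t) ≤ ∑ j, Real.exp (-D.nu * dHat task c j t) :=
    Finset.single_le_sum (f := fun j => Real.exp (-D.nu * dHat task c j t))
      (fun _ _ => (Real.exp_pos _).le) (Finset.mem_univ j)
  have h2 := (Real.le_log_iff_exp_le ((Real.exp_pos _).trans_le h1)).2 h1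
  rw [PrTRAS.TubeDesign.d, neg_mul, neg_le, one_div, inv_mul_eq_div, le_div_iff₀ hν]
  linarith

/-- The right-hand side of the radius law is the derivative of this expression, and the initial
values agree. Both bounds on `r` and its regularity are read off from it. -/
theorem RadiusLaw.eq_softmin (hr : D.RadiusLaw c r) {t : ℝ} (ht : 0 ≤ t) :
    r t = -(1 / D.nu) * Real.log (Real.exp (-D.nu * D.rmax) + Real.exp (-D.nu * D.d c t)) := by
  have hν := D.nu_pos
  set ψ : ℝ → ℝ := fun t => r t - -(1 / D.nu) *
    Real.log (Real.exp (-D.nu * D.rmax) + Real.exp (-D.nu * D.d c t))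
  have hψ : ∀ s, 0 ≤ s → HasDerivWithinAt ψ 0 (Ici 0) s := fun s hs => by
    obtain ⟨d', hd, hrd⟩ := hr.ode s hs
    have hpos : 0 < Real.exp (-D.nu * D.rmax) + Real.exp (-D.nu * D.d c s) := by positivity
    have h1 := ((((hd.const_mul (-D.nu)).exp).const_add (Real.exp (-D.nu * D.rmax))).log
      hpos.ne').const_mul (-(1 / D.nu))
    refine (hrd.sub h1).congr_deriv ?_
    field_simp
    ring
  have hconst := constant_of_has_deriv_right_zero (f := ψ) (a := 0) (b := t)
    (fun s hs => ((hψ s hs.1).continuousWithinAt).mono fun u hu => hu.1)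
    (fun s hs => (hψ s hs.1).mono (Ici_subset_Ici.2 hs.1)) t ⟨ht, le_rfl⟩
  have h0 : ψ 0 = 0 := sub_eq_zero.2 hr.init
  rw [h0] at hconst
  exact sub_eq_zero.1 hconst

theorem RadiusLaw.lt_rmax (hr : D.RadiusLaw c r) {t : ℝ} (ht : 0 ≤ t) : r t < D.rmax := by
  have hν := D.nu_pos
  rw [RadiusLaw.eq_softmin hr ht, neg_mul, neg_lt, one_div, inv_mul_eq_div, lt_div_iff₀ hν]
  have h : -D.nu * D.rmax
      < Real.log (Real.exp (-D.nu * D.rmax) + Real.exp (-D.nu * D.d c t)) := by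
    rw [Real.lt_log_iff_exp_lt (by positivity)]
    linarith [Real.exp_pos (-D.nu * D.d c t)]
  linarith

theorem RadiusLaw.le_d (hr : D.RadiusLaw c r) {t : ℝ} (ht : 0 ≤ t) : r t ≤ D.d c t := by
  have hν := D.nu_pos
  rw [RadiusLaw.eq_softmin hr ht, neg_mul, neg_le, one_div, inv_mul_eq_div, le_div_iff₀ hν]
  have h : -D.nu * D.d c t
      ≤ Real.log (Real.exp (-D.nu * D.rmax) + Real.exp (-D.nu * D.d c t)) := by
    rw [Real.le_log_iff_exp_le (by positivity)]
    linarith [Real.exp_pos (-D.nu * D.rmax)]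
  linarith

theorem continuousOn_q (hn : 0 < n) (hc : ContinuousOn c (Ici 0)) (j : Fin no) :
    ContinuousOn (fun t => D.q j (c t) t) (Ici 0) := by
  have h1 : ContinuousOn (fun t => 1 - (stdGaussian (E n)).real (Metric.ball
      (stdPos ob j t (c t)) (D.safeRadius j t / ob.sd j t))) (Ici 0) := by
    intro t ht
    refine continuousWithinAt_const.sub (tendsto_stdGaussian_ball hn
      (continuousOn_stdPos hc j t ht) ?_)
    exact (((ob.radius_smooth j).continuousOn.add continuousOn_const).div
      (ob.sd_smooth j).continuousOn fun t ht => (ob.sd_pos j t ht).ne') t ht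
  refine h1.congr fun t ht => ?_
  simp only [PrTRAS.TubeDesign.q]
  rw [measureReal_dist_lt ob ht]

variable [IsProbabilityMeasure P]

theorem q_eq (j : Fin no) {t : ℝ} (ht : 0 ≤ t) (x : E n) :
    D.q j x t = P.real {ω | D.safeRadius j t ≤ ‖x - ob.centre j t ω‖} := by
  rw [measureReal_le_dist ob ht, PrTRAS.TubeDesign.q]

/-- `q - eps` is continuous, never zero, and nonnegative at the separation time, so the intermediate
value theorem excludes a change of sign. -/
theorem CentreLaw.eps_lt_q (hn : 0 < n) (hc : D.CentreLaw v c) (hsep : D.EventuallySeparated c)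
    (j : Fin no) {t : ℝ} (ht : 0 ≤ t) : task.eps j < D.q j (c t) t := by
  obtain ⟨t₁, ht₁, hsep⟩ := hsep
  by_contra! hle
  have h1 : task.eps j ≤ D.q j (c t₁) t₁ := by
    rw [q_eq j ht₁]
    exact (D.pd_mem j).1.le.trans (hsep j t₁ le_rfl)
  obtain ⟨s, hs, hs'⟩ := isPreconnected_Ici.intermediate_value ht ht₁
    (continuousOn_q (D := D) hn (CentreLaw.continuousOn hc) j) ⟨hle, h1⟩
  exact hc.denom j s hs hs'

/-- Although the cube root is not Lipschitz, the velocity is continuous in time along `c`, and that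
suffices. -/
theorem CentreLaw.locallyLipschitzOn (hn : 0 < n) (hc : D.CentreLaw v c)
    (hsep : D.EventuallySeparated c) : LocallyLipschitzOn (Ici 0) c := by
  have hcc := CentreLaw.continuousOn hc
  have hattr : ContinuousOn (fun t => D.k1 • cbrtVec (D.eta - c t)) (Ici 0) :=
    (continuous_cbrtVec.comp_continuousOn (continuousOn_const.sub hcc)).const_smul D.k1
  refine locallyLipschitzOn_of_hasDerivWithinAt
    (f' := fun t => D.k1 • cbrtVec (D.eta - c t)
      + ∑ j, D.theta c j t • (D.k2 j • D.m c j t + D.k3 j • v j t)) (fun t ht => hc.ode t ht)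
    (hattr.add (continuousOn_finsetSum _ fun j _ => ?_))
  have hq := continuousOn_q (D := D) hn hcc j
  have hlt : ∀ t ∈ Ici (0 : ℝ), task.eps j < D.q j (c t) t := fun t ht =>
    CentreLaw.eps_lt_q hn hc hsep j ht
  have hpos : ∀ t ∈ Ici (0 : ℝ), D.q j (c t) t ≠ 0 := fun t ht =>
    ((task.eps_mem j).1.trans (hlt t ht)).ne'
  have hθ : ContinuousOn (fun t => D.theta c j t) (Ici 0) := by
    refine ContinuousOn.congr (f := fun t => max (1 / D.q j (c t) t - 1 / D.pd j) 0) ?_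
      fun t ht => theta_eq (hlt t ht)
    exact ((continuousOn_const.div hq hpos).sub continuousOn_const).sup continuousOn_const
  have hm : ContinuousOn (fun t => D.m c j t) (Ici 0) :=
    ((hq.sub continuousOn_const).inv₀ fun t ht => (sub_pos.2 (hlt t ht)).ne').smul
      (hcc.sub (ob.mean_smooth j).continuousOn)
  exact hθ.smul ((hm.const_smul (D.k2 j)).add ((hc.v_cont j).const_smul (D.k3 j)))

/-- The radius law makes `d` differentiable but leaves its derivative possibly unbounded, so the
Lipschitz property is taken from that of the quantile. An obstacle must exist for the sum inside the
logarithm to be positive. -/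
theorem locallyLipschitz_d [Nonempty (Fin no)] (hc : LocallyLipschitz fun t => c (max t 0)) :
    LocallyLipschitz fun t => D.d c (max t 0) := by
  have hdHat : ∀ j t, LipAt (fun t => dHat task c j (max t 0)) t := fun j t => by
    have hmean := ((ob.mean_smooth j).locallyLipschitzOn (convex_Ici 0)).comp_max t
    have hsd := ((ob.sd_smooth j).locallyLipschitzOn (convex_Ici 0)).comp_max t
    have hrad := ((ob.radius_smooth j).locallyLipschitzOn (convex_Ici 0)).comp_max t
    have hpos : ob.sd j (max t 0) ≠ 0 := (ob.sd_pos j _ (le_max_right _ _)).ne'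
    have hb : LipAt (fun t => stdPos ob j (max t 0) (c (max t 0))) t :=
      (LipAt.inv hsd hpos).smul (LipAt.sub (hc t) hmean)
    have hQ := LipAt.comp (f := fun t => stdPos ob j (max t 0) (c (max t 0)))
      (LipAt.of_lipschitzWith (lipschitzWith_sqrt_quantile (stdGaussian (E n))
        (p := 1 - task.eps j) ⟨sub_pos.2 (eps_lt_one D j),
          by linarith [(task.eps_mem j).1]⟩)) hb
    refine (LipAt.sub (LipAt.mul hsd hQ) hrad).congr (Eventually.of_forall fun s => ?_)
    exact dHat_eq task c j (le_max_right s 0)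
  intro t
  refine LipAt.mul (LipAt.const _) (LipAt.log (LipAt.sum fun j _ =>
    ((LipAt.const _).mul (hdHat j t)).exp) ?_)
  exact (Finset.sum_pos (fun j _ => Real.exp_pos _) Finset.univ_nonempty).ne'

theorem RadiusLaw.locallyLipschitz [Nonempty (Fin no)] (hr : D.RadiusLaw c r)
    (hc : LocallyLipschitz fun t => c (max t 0)) : LocallyLipschitz fun t => r (max t 0) := by
  intro t
  have hpos : 0 < Real.exp (-D.nu * D.rmax) + Real.exp (-D.nu * D.d c (max t 0)) := by positivity
  have h1 : LipAt (fun t => -(1 / D.nu) * Real.log (Real.exp (-D.nu * D.rmax)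
      + Real.exp (-D.nu * D.d c (max t 0)))) t :=
    LipAt.mul (LipAt.const _) (LipAt.log (LipAt.add (LipAt.const _)
      ((LipAt.const _).mul (locallyLipschitz_d hc t)).exp) hpos.ne')
  exact h1.congr (Eventually.of_forall fun s => RadiusLaw.eq_softmin hr (le_max_right s 0))

/-- The centre of the tube reaches the centre of the target in finite time. -/
theorem CentreLaw.eventually_eq_eta (hn : 0 < n) (hc : D.CentreLaw v c)
    (hsep : D.EventuallySeparated c) : ∃ tc, 0 ≤ tc ∧ ∀ t, tc ≤ t → c t = D.eta := by
  obtain ⟨t₁, ht₁, hsep'⟩ := id hsep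
  have hode : ∀ t, t₁ ≤ t →
      HasDerivWithinAt c (D.k1 • cbrtVec (D.eta - c t)) (Ici t₁) t := by
    intro t ht
    -- After the separation time the repulsion is switched off and the coordinates decouple into
    -- scalar cube-root equations.
    have h0 : ∀ j, D.theta c j t = 0 := fun j => by
      rw [theta_eq (CentreLaw.eps_lt_q hn hc hsep j (ht₁.trans ht))]
      refine max_eq_right (sub_nonpos.2 (one_div_le_one_div_of_le
        ((task.eps_mem j).1.trans (D.pd_mem j).1) ?_))
      rw [q_eq j (ht₁.trans ht)]
      exact hsep' j t ht
    have h1 := (hc.ode t (ht₁.trans ht)).mono (Ici_subset_Ici.2 ht₁)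
    simpa only [h0, zero_smul, Finset.sum_const_zero, add_zero] using h1
  have hcomp : ∀ i, ∃ t₂, ∀ t, t₂ ≤ t → D.eta i - c t i = 0 := fun i => by
    refine eventually_zero_of_cbrt_ode D.k1_pos (t₁ := t₁) fun t ht => ?_
    have h1 := ((EuclideanSpace.proj i : E n →L[ℝ] ℝ).hasFDerivAt.comp_hasDerivWithinAt t
      (hode t ht)).const_sub (D.eta i)
    exact h1
  choose t₂ ht₂ using hcomp
  refine ⟨∑ i, |t₂ i|, by positivity, fun t ht => ?_⟩
  ext i
  have h1 := Finset.single_le_sum (f := fun i => |t₂ i|) (fun i _ => abs_nonneg _)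
    (Finset.mem_univ i)
  exact (sub_eq_zero.1 (ht₂ i t ((le_abs_self _).trans (h1.trans ht)))).symm

/-- Curves inside the tube satisfy the task. -/
theorem satisfies_of_mem_tube (hn : 0 < n) (hc : D.CentreLaw v c) (hsep : D.EventuallySeparated c)
    (hr : D.RadiusLaw c r) {y : ℝ → E n} (hy : ∀ t, 0 ≤ t → y t ∈ tube c r t) :
    task.Satisfies y := by
  refine ⟨D.ball_S ?_, ?_, fun j t ht => ?_⟩
  · rw [← hc.init]
    exact Metric.closedBall_subset_closedBall ((RadiusLaw.lt_rmax hr le_rfl).le.trans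
      (D.rmax_le.trans (min_le_left _ _))) (hy 0 le_rfl)
  · obtain ⟨tc, htc, heq⟩ := CentreLaw.eventually_eq_eta hn hc hsep
    refine ⟨tc, htc, fun t ht => D.ball_T ?_⟩
    rw [← heq t ht]
    exact Metric.closedBall_subset_closedBall ((RadiusLaw.lt_rmax hr (htc.trans ht)).le.trans
      (D.rmax_le.trans (min_le_right _ _))) (hy t (htc.trans ht))
  · have h1 := mem_closedBall_iff_norm.1 (hy t ht)
    exact eps_le_of_dist_le_dHat task c j (eps_lt_one D j) ht
      (h1.trans ((RadiusLaw.le_d hr ht).trans (d_le_dHat j t)))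

end Tube

theorem theorem2 {Ω : Type*} [MeasurableSpace Ω] (P : Measure Ω) [IsProbabilityMeasure P]
    {N n no : ℕ} (hN : 0 < N) (hn : 0 < n) (hno : 0 < no)
    -- the system and its disturbances
    (sys : PureFeedbackSystem N n) (hlip : sys.LocLipschitz) (hpd : sys.UniformlyPosDef)
    (w : Fin N → ℝ → E n) (hw : IsDisturbance w)
    -- the obstacles, the task and the tube
    (ob : Obstacles P n no) (task : RASTask ob) (D : TubeDesign task)
    (v : Fin no → ℝ → E n) (c : ℝ → E n) (r : ℝ → ℝ)
    (hc : D.CentreLaw v c) (hsep : D.EventuallySeparated c) (hr : D.RadiusLaw c r)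
    -- the controller and the initial state
    (C : ControlParams N n) (x0 : Fin N → E n)
    (hx0 : ‖x0 ⟨0, hN⟩ - c 0‖ < r 0) (herr : C.InitialErrors c r x0) :
    -- the closed loop has a solution for all time, it is unique, and so on every `[0, T]`
    ∃ x : ℝ → Fin N → E n, x 0 = x0 ∧
      (∀ T, 0 ≤ T → sys.IsSolutionOn (C.input hN c r) w x T) ∧
      (∀ T, 0 ≤ T → ∀ z : ℝ → Fin N → E n, z 0 = x0 →
        sys.IsSolutionOn (C.input hN c r) w z T → ∀ t ∈ Icc 0 T, z t = x t) ∧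
      -- the output stays in the tube and meets the task
      (∀ t, 0 ≤ t → x t ⟨0, hN⟩ ∈ tube c r t) ∧
      task.Satisfies (fun t => x t ⟨0, hN⟩) := by
  have hne : Nonempty (Fin no) := ⟨⟨0, hno⟩⟩
  have hcL := (CentreLaw.locallyLipschitzOn hn hc hsep).comp_max
  obtain ⟨x, hxi, hsol, huniq, hin⟩ := exists_unique_closedLoop_solution hlip hpd hw hcL
    (RadiusLaw.locallyLipschitz hr hcL) hr.pos hx0 herr
  have htube : ∀ t, 0 ≤ t → x t ⟨0, hN⟩ ∈ tube c r t := fun t ht =>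
    mem_closedBall_iff_norm.2 (hin t ht).le
  exact ⟨x, hxi, hsol, huniq, htube, satisfies_of_mem_tube hn hc hsep hr htube⟩
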